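/- For every integer $n \ge 2$ there are constants $C_n$ and $m_n$, depending only on $n$, such that the following holds. Let $\mathbf F$ be a finite field of characteristic $p$, and let $N \trianglelefteq \Gamma \le \mathrm{GL}_n(\mathbf F)$. Assume that the section $\Sigma = \Gamma/N$ is trigonalizable, i.e. that there is a subgroup $B \le \mathrm{GL}_n(\mathbf F)$ which is conjugate, over some extension field $\mathbf E$ of $\mathbf F$, to a group of upper-triangular matrices in $\mathrm{GL}_n(\mathbf E)$, and such that $B \cap \Gamma$ maps onto $\Sigma$. Let $O_p(\Sigma)$ be the largest normal $p$-subgroup of $\Sigma$. A root of $\Sigma$ is a quotient homomorphism $\chi : \Sigma \to \Sigma/C_\Sigma(V)$, where $V$ is a $\Sigma$-composition factor of $O_p(\Sigma)$ (that is, $V = X/Y$ with $Y < X \le O_p(\Sigma)$ both normal in $\Sigma$ and with no normal subgroup of $\Sigma$ strictly between them) and $C_\Sigma(V)$ is the kernel of the conjugation action of $\Sigma$ on $V$. For real $R$, a set $A \subseteq \Sigma$ is said to have no $R$-small roots if there is no nontrivial root $\chi$ of $\Sigma$ with $1 < |\chi(A)| \le R$. Let $K$ be a real number and let $A \subseteq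 \Sigma$ be a set with $A = A^{-1}$ and $1 \in A$ such that (i) $|A^3| \le K|A|$, (ii) $A$ has no $K^{C_n}$-small roots, (iii) $A$ generates $\Sigma$. Then $\gamma_n(\Sigma) \subseteq A^{m_n}$, where $A^k = \{a_1\cdots a_k : a_1,\dots,a_k \in A\}$ and $\gamma_1(\Sigma) = \Sigma$, $\gamma_{k+1}(\Sigma) = [\gamma_k(\Sigma), \Sigma]$ is the lower central series. -/

import Mathlib

open scoped Pointwise

/-- A subgroup `B` of `GL_n(F)` is trigonalizable if, over some extension field `E` of `F`, it is
conjugate in `GL_n(E)` to a group of upper-triangular matrices. -/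
def IsTrigonalizable.{u} {n : ℕ} {F : Type u} [Field F]
    (B : Subgroup (Matrix.GeneralLinearGroup (Fin n) F)) : Prop :=
  ∃ (E : Type u) (_ : Field E) (_ : Algebra F E) (g : Matrix.GeneralLinearGroup (Fin n) E),
    ∀ b ∈ B, Matrix.BlockTriangular
      ((g * Matrix.GeneralLinearGroup.map (algebraMap F E) b * g⁻¹ :
        Matrix.GeneralLinearGroup (Fin n) E) : Matrix (Fin n) (Fin n) E) id

/-- The trace of a subset `A ⊆ G` in the section `H ⧸ N` of `G`: the image of `A ∩ H`. -/
def sectionTrace {G : Type*} [Group G] (A : Set G) (H : Subgroup G) (N : Subgroup H) :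
    Set (H ⧸ N) :=
  (fun x : H => (x : H ⧸ N)) '' {x : H | (x : G) ∈ A}

/-- The section `Γ ⧸ N` of `GL_n(F)` is trigonalizable if it is the trace of a trigonalizable
subgroup. -/
def IsTrigonalizableSection {n : ℕ} {F : Type*} [Field F]
    (Γ : Subgroup (Matrix.GeneralLinearGroup (Fin n) F)) (N : Subgroup Γ) : Prop :=
  ∃ B : Subgroup (Matrix.GeneralLinearGroup (Fin n) F),
    IsTrigonalizable B ∧ sectionTrace (B : Set (Matrix.GeneralLinearGroup (Fin n) F)) Γ N = Set.univ

/-- The `p`-core `O_p(S)`: the join of all normal `p`-subgroups, which for a finite group `S` is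
the largest normal `p`-subgroup. -/
def pCore (p : ℕ) (S : Type*) [Group S] : Subgroup S :=
  sSup {P : Subgroup S | P.Normal ∧ IsPGroup p P}

/-- The `S`-composition factors `top / bot` of a subgroup `U` of `S`, where `S` acts by
conjugation: `bot < top ≤ U` are `S`-invariant (that is, normal in `S`), with no `S`-invariant
subgroup strictly between them. -/
structure CompositionFactor {S : Type*} [Group S] (U : Subgroup S) where
  top : Subgroup S
  bot : Subgroup S
  top_normal : top.Normal
  bot_normal : bot.Normal
  top_le : top ≤ U
  bot_lt_top : bot < top
  eq_or_eq : ∀ Z : Subgroup S, Z.Normal → bot ≤ Z → Z ≤ top → Z = bot ∨ Z = top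

namespace CompositionFactor

instance instTopNormal {S : Type*} [Group S] {U : Subgroup S} (V : CompositionFactor U) :
    V.top.Normal := V.top_normal

instance instBotNormal {S : Type*} [Group S] {U : Subgroup S} (V : CompositionFactor U) :
    V.bot.Normal := V.bot_normal

/-- The centralizer `C_S(V)` of the composition factor `V = top / bot`: the elements of `S` acting
trivially on `V` by conjugation. -/
def rootKernel {S : Type*} [Group S] {U : Subgroup S} (V : CompositionFactor U) : Subgroup S where
  carrier := {g | ∀ x ∈ V.top, g * x * g⁻¹ * x⁻¹ ∈ V.bot}
  one_mem' := by
    intro x _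
    simp [V.bot.one_mem]
  mul_mem' := by
    intro a b ha hb x hx
    have h1 := ha _ (V.top_normal.conj_mem x hx b)
    have h2 := V.bot.mul_mem h1 (hb x hx)
    simpa [mul_assoc] using h2
  inv_mem' := by
    intro a ha x hx
    have h1 := V.bot.inv_mem (ha _ (V.top_normal.conj_mem x hx a⁻¹))
    simpa [mul_assoc] using h1

instance instRootKernelNormal {S : Type*} [Group S] {U : Subgroup S} (V : CompositionFactor U) :
    V.rootKernel.Normal where
  conj_mem := by
    intro a ha g x hx
    have h1 := V.bot_normal.conj_mem _ (ha _ (V.top_normal.conj_mem x hx g⁻¹)) g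
    simpa [mul_assoc] using h1

/-- The root attached to a composition factor `V`: the quotient map `S → S / C_S(V)`. -/
def root {S : Type*} [Group S] {U : Subgroup S} (V : CompositionFactor U) :
    S →* S ⧸ V.rootKernel :=
  QuotientGroup.mk' V.rootKernel

end CompositionFactor

/-- `A ⊆ S` has no `R`-small roots: there is no nontrivial root `χ` of `S`, arising from an
`S`-composition factor of `O_p(S)`, such that `1 < |χ(A)| ≤ R`. -/
def HasNoSmallRoots (p : ℕ) {S : Type*} [Group S] (A : Set S) (R : ℝ) : Prop :=
  ¬ ∃ V : CompositionFactor (pCore p S),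
    V.root ≠ 1 ∧ 1 < (V.root '' A).ncard ∧ ((V.root '' A).ncard : ℝ) ≤ R

/-- The lower central series with the indexing `γ_1(S) = S`, `γ_{k+1}(S) = [γ_k(S), S]`,
for `k ≥ 1`. -/
def gammaSeries (S : Type*) [Group S] (k : ℕ) : Subgroup S :=
  (⊤ : Subgroup S).lowerCentralSeries (k - 1)

/-! Triangular matrices exhibit Σ as `U 0 ⊔ T`, with `U 0` a normal `p`-group (the image of the
unipotent matrices) and `T` abelian of order prime to `p`. Enumerating the entries above the
diagonal by superdiagonals refines `U 0` to a central series in which each layer comes from one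
matrix entry. A group element scales that entry, so it acts on the layer either trivially or without
nontrivial fixed points. This dichotomy survives in quotients of finite groups, and the absence of
small roots says that `A` has many images in the automorphism group of every layer with nontrivial
action.

Put D = `⁅U 0, T⁆`. The superdiagonals give a central series of `U 0` of length n - 1, so γ_n(Σ) ≤
D. Coprime action gives D = [D, DT], so D lies in every term of the lower central series of Σ and
equals a late one; hence it is normally generated by short words in `A`. It remains to cover D by a
bounded power of `A`.

Let M_k be the k-th term of the lower central series of D, with M_0 = D, and P_k = [M_k, DT], so
that M_k ≥ P_k ≥ M_{k+1}. One shows D ⊆ A^a X for X running down the chain P_0 = D, M_1, P_1, M_2,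
..., with a growing in a controlled way. Two mechanisms are needed.

From P_k to M_{k+1}: by a norm argument `T` has no nontrivial fixed points on P_k / M_{k+1}. Going
through the layers one at a time, a pivoting argument of sum-product type
(`exists_add_eq_of_pivotSet_small`) applies: `A` acts on an abelian normal section by many commuting
automorphisms with injective differences, while bounded growth keeps the words in the section few.
So the normal subgroup generated by short words consists of slightly longer words
(`exists_normal_le_pow`, `subset_pow_of_semiregular`).

From M_{k+1} to P_{k+1}: modulo P_{k+1} the group M_{k+1} = [M_k, D] is centralized by DT, so
nothing acts and pivoting is useless. But a commutator [x, y] then depends only on x and y modulo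
this central subgroup, hence is a short word. A nontrivial character of the section yields a
bilinear pairing with image larger than `R` (`lt_ncard_range`), so commutators are equidistributed
in the Fourier sense and the short words have sumset everything (`exists_add_eq_of_fourier_small`,
`subset_pow_of_central`). -/

open scoped commutatorElement

/-! ### Elementary counting in abelian groups -/

open Finset in
/-- A subset of more than half the size of a finite subgroup is an additive basis of order two. -/
lemma exists_add_eq_of_card_lt_two_mul {V : Type*} [AddCommGroup V] [Finite V] (H : AddSubgroup V)
    (Q : Finset V) (hQ : ∀ q ∈ Q, q ∈ H) (hcard : Nat.card H < 2 * #Q) {v : V} (hv : v ∈ H) :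
    ∃ q₁ ∈ Q, ∃ q₂ ∈ Q, v = q₁ + q₂ := by
  classical
  have := Fintype.ofFinite V
  by_contra! hne
  have hdisj : Disjoint Q (Q.image fun q => v - q) := by
    rw [Finset.disjoint_left]
    intro q hq hq'
    obtain ⟨r, hr, hrq⟩ := Finset.mem_image.1 hq'
    exact hne q hq r hr (by rw [← hrq]; abel)
  have hsub : Q ∪ Q.image (fun q => v - q) ⊆ Finset.univ.filter (· ∈ H) := by
    intro x hx
    simp only [Finset.mem_filter, Finset.mem_univ, true_and]
    rcases Finset.mem_union.1 hx with h | h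
    · exact hQ x h
    · obtain ⟨r, hr, rfl⟩ := Finset.mem_image.1 h
      exact H.sub_mem hv (hQ r hr)
  have h1 := Finset.card_le_card hsub
  rw [Finset.card_union_of_disjoint hdisj,
    Finset.card_image_of_injective _ (sub_right_injective)] at h1
  have h2 : #(Finset.univ.filter (· ∈ H)) = Nat.card H := by
    rw [Nat.card_eq_fintype_card, Fintype.card_subtype]
  omega

open Finset in
/-- Cauchy–Schwarz: the number of collisions of a map is at least the square of the size of
its domain divided by the size of its image. -/
lemma card_sq_le_card_image_mul_collisions {α β : Type*} [DecidableEq β] (s : Finset α)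
    (f : α → β) :
    #s ^ 2 ≤ #(s.image f) * #((s ×ˢ s).filter fun x => f x.1 = f x.2) := by
  classical
  have h1 : #s = ∑ b ∈ s.image f, #(s.filter fun a => f a = b) :=
    card_eq_sum_card_fiberwise (fun a ha => mem_image_of_mem f ha)
  have h2 : #((s ×ˢ s).filter fun x => f x.1 = f x.2)
      = ∑ b ∈ s.image f, #(s.filter fun a => f a = b) ^ 2 := by
    rw [card_eq_sum_card_fiberwise (f := fun x => f x.1) (t := s.image f)]
    · refine sum_congr rfl fun b _ => ?_
      rw [sq, ← card_product]
      congr 1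
      ext ⟨x, y⟩
      simp only [mem_filter, mem_product]
      constructor
      · rintro ⟨⟨⟨hx, hy⟩, hxy⟩, hb⟩
        exact ⟨⟨hx, hb⟩, hy, hxy ▸ hb⟩
      · rintro ⟨⟨hx, hb⟩, hy, hb'⟩
        exact ⟨⟨⟨hx, hy⟩, hb.trans hb'.symm⟩, hb⟩
    · intro x hx
      simp only [coe_filter, mem_product, Set.mem_ofPred_eq] at hx
      exact mem_coe.2 (mem_image_of_mem f hx.1.1)
  rw [h2]
  conv_lhs => rw [h1]
  exact sq_sum_le_card_mul_sum_sq

/-! ### The pivoting argument -/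

/-- The subset of `V` reached from `W` and the automorphisms in `S` by the pivoting argument. -/
def pivotSet {V : Type*} [AddCommGroup V] (S : Finset (V ≃+ V)) (W : Finset V) : Set V :=
  {v | ∃ s ∈ S, ∃ s' ∈ S, ∃ s₁ ∈ S, ∃ s₂ ∈ S, ∃ w₀ ∈ W, ∃ w ∈ W, ∃ w' ∈ W, ∃ w'' ∈ W,
    v = (s w₀ - s' w₀) + (s₁ (s₂ w) - s₁ (s₂ w')) + (s (s₁ w'') - s' (s₁ w''))}

section Pivot

open Finset

variable {V : Type*} [AddCommGroup V] {S : Finset (V ≃+ V)} {W Q : Finset V}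

/-- `ξ` is a pivot if the map `(w, s) ↦ w + s ξ` is injective on `W × S`. -/
def IsPivot (S : Finset (V ≃+ V)) (W : Finset V) (ξ : V) : Prop :=
  ∀ w ∈ W, ∀ w' ∈ W, ∀ s ∈ S, ∀ s' ∈ S, w + s ξ = w' + s' ξ → s = s' ∧ w = w'

/-- A collision turns the uncontrolled element `s ξ - s' ξ` into a difference of elements of `W`.
Applying `s - s'` to sums built from `W` and `ξ` therefore eliminates `ξ` and lands in the pivot
set. -/
lemma exists_of_not_isPivot {ξ : V} (h : ¬ IsPivot S W ξ) :
    ∃ s ∈ S, ∃ s' ∈ S, s ≠ s' ∧ ∃ w ∈ W, ∃ w' ∈ W, s ξ - s' ξ = w - w' := by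
  unfold IsPivot at h
  push Not at h
  obtain ⟨w, hw, w', hw', s, hs, s', hs', he, hne⟩ := h
  refine ⟨s, hs, s', hs', ?_, w', hw', w, hw, ?_⟩
  · rintro rfl
    exact hne rfl (add_right_cancel he)
  · rw [sub_eq_sub_iff_add_eq_add, add_comm, he]

lemma sub_apply_injective (hfree : ∀ s ∈ S, ∀ s' ∈ S, s ≠ s' → ∀ v : V, s v = s' v → v = 0)
    {s s' : V ≃+ V} (hs : s ∈ S) (hs' : s' ∈ S) (hne : s ≠ s') :
    Function.Injective fun v => s v - s' v := by
  intro x y hxy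
  have : s (x - y) = s' (x - y) := by
    simp only [map_sub]
    have h : s x - s' x = s y - s' y := hxy
    rw [sub_eq_sub_iff_sub_eq_sub] at h
    exact h
  exact sub_eq_zero.1 (hfree s hs s' hs' hne _ this)

lemma card_image_pivot [DecidableEq V] {ξ : V} (h : IsPivot S W ξ) :
    #((W ×ˢ S).image fun x => x.1 + x.2 ξ) = #W * #S := by
  rw [card_image_of_injOn, card_product]
  rintro ⟨w, s⟩ hx ⟨w', s'⟩ hy he
  simp only [coe_product, Set.mem_prod, mem_coe] at hx hy
  obtain ⟨rfl, rfl⟩ := h w hx.1 w' hy.1 s hx.2 s' hy.2 he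
  rfl

/-- The pivoting argument: if `S` is a commuting set of automorphisms whose differences are
injective, and the pivot set of `S` and `W` is small compared to `|W||S|`, then twice the pivot set
covers the `S`-stable subgroup generated by `W`. -/
theorem exists_add_eq_of_pivotSet_small [Finite V] (hS1 : AddEquiv.refl V ∈ S) (hS2 : 2 ≤ #S)
    (hW0 : 0 ∈ W)
    (hcomm : ∀ s ∈ S, ∀ s' ∈ S, ∀ v : V, s (s' v) = s' (s v))
    (hfree : ∀ s ∈ S, ∀ s' ∈ S, s ≠ s' → ∀ v : V, s v = s' v → v = 0)
    (hQ : ∀ v ∈ pivotSet S W, v ∈ Q) (hsmall : 2 * #Q < #W * #S)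
    (H : AddSubgroup V) (hWH : ∀ w ∈ W, w ∈ H) (hSH : ∀ s ∈ S, ∀ v ∈ H, s v ∈ H)
    (hmin : ∀ H' : AddSubgroup V, (∀ w ∈ W, w ∈ H') → (∀ s ∈ S, ∀ v ∈ H', s v ∈ H') → H ≤ H') :
    ∀ v ∈ H, ∃ q₁ ∈ Q, ∃ q₂ ∈ Q, v = q₁ + q₂ := by
  classical
  have := Fintype.ofFinite V
  -- the image of `W + S η` under `s - s'` has the same size as `W + S η`
  have key : ∀ η : V, ∀ s ∈ S, ∀ s' ∈ S, s ≠ s' →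
      (∀ w ∈ W, ∀ t ∈ S, s (w + t η) - s' (w + t η) ∈ Q) →
      #((W ×ˢ S).image fun x => x.1 + x.2 η) ≤ #Q := by
    intro η s hs s' hs' hne h
    rw [← card_image_of_injective _ (sub_apply_injective hfree hs hs' hne)]
    refine card_le_card ?_
    intro v hv
    simp only [mem_image, mem_product, Prod.exists] at hv
    obtain ⟨_, ⟨w, t, ⟨hw, ht⟩, rfl⟩, rfl⟩ := hv
    exact h w hw t ht
  have hgrow : ∀ η : V, IsPivot S W η → ∀ s ∈ S, ∀ s' ∈ S, s ≠ s' →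
      ¬ ∀ w ∈ W, ∀ t ∈ S, s (w + t η) - s' (w + t η) ∈ Q := by
    intro η hη s hs s' hs' hne h
    have := key η s hs s' hs' hne h
    rw [card_image_pivot hη] at this
    omega
  have hzero : ¬ IsPivot S W 0 := by
    intro h
    obtain ⟨s, hs, s', hs', hne⟩ := one_lt_card.1 hS2
    exact hne (h 0 hW0 0 hW0 s hs s' hs' (by simp)).1
  -- If ξ is not a pivot, then (s - s')(a + t(ξ + w₀)) = (s - s')a + t(w - w') + (s - s')t w₀ lies
  -- in the pivot set. A pivot ξ + w₀ would give |W||S| such elements, more than `Q` holds. The same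
  -- computation with s₀ ξ in place of ξ + w₀ gives `hmul`.
  have hadd : ∀ ξ, ¬ IsPivot S W ξ → ∀ w₀ ∈ W, ¬ IsPivot S W (ξ + w₀) := by
    intro ξ hξ w₀ hw₀ hp
    obtain ⟨s, hs, s', hs', hne, w, hw, w', hw', he⟩ := exists_of_not_isPivot hξ
    refine hgrow _ hp s hs s' hs' hne fun a ha t ht => hQ _ ?_
    refine ⟨s, hs, s', hs', t, ht, AddEquiv.refl V, hS1, a, ha, w, hw, w', hw', w₀, hw₀, ?_⟩
    have : t (s ξ) - t (s' ξ) = t w - t w' := by rw [← map_sub, he, map_sub]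
    simp only [map_add, AddEquiv.refl_apply]
    rw [← this, hcomm s hs t ht ξ, hcomm s' hs' t ht ξ]
    abel
  have hmul : ∀ ξ, ¬ IsPivot S W ξ → ∀ s₀ ∈ S, ¬ IsPivot S W (s₀ ξ) := by
    intro ξ hξ s₀ hs₀ hp
    obtain ⟨s, hs, s', hs', hne, w, hw, w', hw', he⟩ := exists_of_not_isPivot hξ
    refine hgrow _ hp s hs s' hs' hne fun a ha t ht => hQ _ ?_
    refine ⟨s, hs, s', hs', t, ht, s₀, hs₀, a, ha, w, hw, w', hw', 0, hW0, ?_⟩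
    have : t (s₀ (s ξ)) - t (s₀ (s' ξ)) = t (s₀ w) - t (s₀ w') := by
      rw [← map_sub, ← map_sub, he, map_sub, map_sub]
    simp only [map_add, map_zero, sub_zero, add_zero]
    rw [← this, hcomm s hs t ht, hcomm s' hs' t ht, hcomm s hs s₀ hs₀, hcomm s' hs' s₀ hs₀]
    abel
  -- By finiteness, the injection `s` permutes the set of non-pivots, which it maps into itself.
  have hsurj : ∀ s ∈ S, ∀ ξ, ¬ IsPivot S W ξ → ¬ IsPivot S W (s.symm ξ) := by
    intro s hs ξ hξ
    let N := (univ : Finset V).filter fun v => ¬ IsPivot S W v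
    have hN : N.image s = N := by
      refine eq_of_subset_of_card_le ?_ (by rw [card_image_of_injective _ s.injective])
      intro x hx
      obtain ⟨y, hy, rfl⟩ := mem_image.1 hx
      simp only [N, mem_filter, mem_univ, true_and] at hy ⊢
      exact hmul y hy s hs
    have hξN : ξ ∈ N.image s := by rw [hN]; simpa [N] using hξ
    obtain ⟨y, hy, rfl⟩ := mem_image.1 hξN
    simpa [N] using hy
  -- no element of `H` is a pivot
  have hHnot : ∀ v ∈ H, ¬ IsPivot S W v := by
    -- Consider the translations preserving the set of non-pivots. They form a subgroup, negatives
    -- being multiples in a finite group. It is stable under `S` because ξ + s v = s(s⁻¹ξ + v).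
    let M : AddSubmonoid V :=
      { carrier := {v | ∀ ξ, ¬ IsPivot S W ξ → ¬ IsPivot S W (ξ + v)}
        zero_mem' := by intro ξ hξ; simpa using hξ
        add_mem' := by
          intro a b ha hb ξ hξ
          rw [← add_assoc]
          exact hb _ (ha _ hξ) }
    let H' : AddSubgroup V :=
      { M with
        neg_mem' := by
          intro x hx
          have hx' : x ∈ M := hx
          have : -x = (addOrderOf x - 1) • x := by
            have hpos : 0 < addOrderOf x := addOrderOf_pos x
            have h : (addOrderOf x - 1) • x + x = 0 := by
              rw [← succ_nsmul, Nat.sub_add_cancel hpos, addOrderOf_nsmul_eq_zero]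
            exact (eq_neg_of_add_eq_zero_left h).symm
          change -x ∈ M
          rw [this]
          exact M.nsmul_mem hx' _ }
    have hle : H ≤ H' := by
      refine hmin H' (fun w hw ξ hξ => hadd ξ hξ w hw) ?_
      intro s hs v hv ξ hξ
      have h1 := hmul _ (hv _ (hsurj s hs ξ hξ)) s hs
      simpa using h1
    intro v hv
    have := hle hv 0 hzero
    simpa using this
  -- collisions on average
  obtain ⟨ξ, hξH, hξ⟩ : ∃ ξ ∈ H, Nat.card H < 2 * #((W ×ˢ S).image fun x => x.1 + x.2 ξ) := by
    -- Two lower bounds on the collision total contradict the upper bound |H|n + n², where n =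
    -- |W||S|. Images of size at most |H|/2 force a total of at least 2n². Images of size at most
    -- |Q| < n/2, available since no ξ in `H` is a pivot, force a total above 2|H|n.
    by_contra! hcon
    let c : V → ℕ := fun ξ => #(((W ×ˢ S) ×ˢ (W ×ˢ S)).filter
      fun x => x.1.1 + x.1.2 ξ = x.2.1 + x.2.2 ξ)
    let HF : Finset V := univ.filter (· ∈ H)
    have hHF : #HF = Nat.card H := by
      rw [Nat.card_eq_fintype_card, Fintype.card_subtype]
    have hN : #(W ×ˢ S) = #W * #S := card_product _ _
    set n := #W * #S with hn
    have hcol : ∑ ξ ∈ HF, c ξ ≤ #HF * n + n ^ 2 := by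
      have e1 : ∑ ξ ∈ HF, c ξ = ∑ x ∈ (W ×ˢ S) ×ˢ (W ×ˢ S),
          #(HF.filter fun ξ => x.1.1 + x.1.2 ξ = x.2.1 + x.2.2 ξ) := by
        simp only [c, card_filter]
        rw [sum_comm]
      rw [e1]
      have e2 : ∀ x ∈ (W ×ˢ S) ×ˢ (W ×ˢ S),
          #(HF.filter fun ξ => x.1.1 + x.1.2 ξ = x.2.1 + x.2.2 ξ)
            ≤ (if x.1 = x.2 then #HF else 0) + 1 := by
        rintro ⟨⟨w, s⟩, ⟨w', s'⟩⟩ hx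
        simp only [mem_product] at hx
        by_cases hss : s = s'
        · subst hss
          by_cases hww : w = w'
          · subst hww
            simp
          · have : HF.filter (fun ξ => w + s ξ = w' + s ξ) = ∅ := by
              ext ξ
              simp [hww]
            rw [this]
            simp
        · refine le_trans ?_ (Nat.le_add_left _ _)
          rw [card_le_one]
          intro a ha b hb
          simp only [mem_filter] at ha hb
          refine sub_apply_injective hfree hx.1.2 hx.2.2 hss ?_
          have h1 : s a - s' a = w' - w := by
            rw [sub_eq_sub_iff_add_eq_add, add_comm, ha.2]
          have h2 : s b - s' b = w' - w := by
            rw [sub_eq_sub_iff_add_eq_add, add_comm, hb.2]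
          exact h1.trans h2.symm
      refine (sum_le_sum e2).trans ?_
      rw [sum_add_distrib, sum_const, card_product, hN, smul_eq_mul, mul_one, ← sq]
      refine Nat.add_le_add_right ?_ _
      rw [sum_product]
      have e3 : ∀ x ∈ W ×ˢ S, ∑ y ∈ W ×ˢ S, (if (x, y).1 = (x, y).2 then #HF else 0) = #HF := by
        intro x hx
        rw [sum_ite_eq]
        simp only [hx, if_true]
      rw [sum_congr rfl e3, sum_const, hN, smul_eq_mul, mul_comm]
    have hpt : ∀ ξ ∈ HF, 2 * n ^ 2 ≤ #HF * c ξ ∧ n ^ 2 ≤ #Q * c ξ := by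
      intro ξ hξ
      have hξH : ξ ∈ H := by simpa [HF] using hξ
      have h1 := card_sq_le_card_image_mul_collisions (W ×ˢ S) (fun x => x.1 + x.2 ξ)
      rw [hN] at h1
      change n ^ 2 ≤ _ * c ξ at h1
      have h2 := hcon ξ hξH
      rw [← hHF] at h2
      have h3 : #((W ×ˢ S).image fun x => x.1 + x.2 ξ) ≤ #Q := by
        obtain ⟨s, hs, s', hs', hne, w, hw, w', hw', he⟩ := exists_of_not_isPivot (hHnot ξ hξH)
        refine key ξ s hs s' hs' hne fun a ha t ht => hQ _ ?_
        refine ⟨s, hs, s', hs', t, ht, AddEquiv.refl V, hS1, a, ha, w, hw, w', hw', 0, hW0, ?_⟩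
        have : t (s ξ) - t (s' ξ) = t w - t w' := by rw [← map_sub, he, map_sub]
        simp only [map_add, AddEquiv.refl_apply, map_zero, sub_zero, add_zero]
        rw [← this, hcomm s hs t ht ξ, hcomm s' hs' t ht ξ]
        abel
      constructor
      · calc 2 * n ^ 2 ≤ 2 * (_ * c ξ) := Nat.mul_le_mul_left _ h1
          _ = (2 * _) * c ξ := by ring
          _ ≤ _ := Nat.mul_le_mul_right _ h2
      · exact h1.trans (Nat.mul_le_mul_right _ h3)
    have hnpos : 0 < n := by omega
    have hHFpos : 0 < #HF := card_pos.2 ⟨0, by simp [HF]⟩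
    have hA : #HF * (2 * n ^ 2) ≤ #HF * ∑ ξ ∈ HF, c ξ := by
      rw [mul_sum, ← smul_eq_mul, ← sum_const]
      exact sum_le_sum fun ξ hξ => (hpt ξ hξ).1
    have hB : #HF * n ^ 2 ≤ #Q * ∑ ξ ∈ HF, c ξ := by
      rw [mul_sum, ← smul_eq_mul, ← sum_const]
      exact sum_le_sum fun ξ hξ => (hpt ξ hξ).2
    set Sc := ∑ ξ ∈ HF, c ξ
    have hA' : 2 * n ^ 2 ≤ Sc := Nat.le_of_mul_le_mul_left hA hHFpos
    have hB' : 2 * #HF * n ^ 2 < n * Sc := by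
      have hpos : 0 < Sc := lt_of_lt_of_le (by positivity) hA'
      calc 2 * #HF * n ^ 2 = 2 * (#HF * n ^ 2) := by ring
        _ ≤ 2 * (#Q * Sc) := Nat.mul_le_mul_left _ hB
        _ = (2 * #Q) * Sc := by ring
        _ < n * Sc := Nat.mul_lt_mul_of_pos_right hsmall hpos
    have hB'' : 2 * #HF * n < Sc := by
      refine Nat.lt_of_mul_lt_mul_left (a := n) ?_
      calc n * (2 * #HF * n) = 2 * #HF * n ^ 2 := by ring
        _ < _ := hB'
    nlinarith
  -- transfer to `Q`
  obtain ⟨s, hs, s', hs', hne, w, hw, w', hw', he⟩ := exists_of_not_isPivot (hHnot ξ hξH)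
  have hsub : ∀ q ∈ ((W ×ˢ S).image fun x => x.1 + x.2 ξ).image (fun v => s v - s' v),
      q ∈ Q ∧ q ∈ H := by
    intro q hq
    simp only [mem_image, mem_product, Prod.exists] at hq
    obtain ⟨_, ⟨a, t, ⟨ha, ht⟩, rfl⟩, rfl⟩ := hq
    have hmem : a + t ξ ∈ H := H.add_mem (hWH a ha) (hSH t ht ξ hξH)
    refine ⟨hQ _ ⟨s, hs, s', hs', t, ht, AddEquiv.refl V, hS1, a, ha, w, hw, w', hw', 0, hW0, ?_⟩,
      H.sub_mem (hSH s hs _ hmem) (hSH s' hs' _ hmem)⟩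
    have : t (s ξ) - t (s' ξ) = t w - t w' := by rw [← map_sub, he, map_sub]
    simp only [map_add, AddEquiv.refl_apply, map_zero, sub_zero, add_zero]
    rw [← this, hcomm s hs t ht ξ, hcomm s' hs' t ht ξ]
    abel
  intro v hv
  rw [← card_image_of_injective _ (sub_apply_injective hfree hs hs' hne)] at hξ
  obtain ⟨q₁, hq₁, q₂, hq₂, h⟩ :=
    exists_add_eq_of_card_lt_two_mul H _ (fun q hq => (hsub q hq).2) hξ hv
  exact ⟨q₁, (hsub _ hq₁).1, q₂, (hsub _ hq₂).1, h⟩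

end Pivot

/-! ### Covering from small Fourier coefficients -/

section Fourier

open Finset

variable {V : Type*} [AddCommGroup V]

/-- Parseval's identity for the push-forward of the counting measure on `s` under `f`. -/
lemma card_mul_collisions_eq_sum_norm_sq [Fintype V] [DecidableEq V] {α : Type*} (s : Finset α)
    (f : α → V) :
    (Fintype.card V : ℝ) * #((s ×ˢ s).filter fun x => f x.1 = f x.2)
      = ∑ ψ : AddChar V ℂ, ‖∑ x ∈ s, ψ (f x)‖ ^ 2 := by
  have h1 : ∀ ψ : AddChar V ℂ, ((‖∑ x ∈ s, ψ (f x)‖ ^ 2 : ℝ) : ℂ)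
      = ∑ x ∈ s ×ˢ s, ψ (f x.1 - f x.2) := by
    intro ψ
    rw [Complex.ofReal_pow, ← Complex.mul_conj', map_sum, sum_mul_sum, sum_product]
    refine sum_congr rfl fun x _ => sum_congr rfl fun y _ => ?_
    rw [sub_eq_add_neg, AddChar.map_add_eq_mul, AddChar.map_neg_eq_conj]
  apply Complex.ofReal_injective
  push_cast
  simp only [← Complex.ofReal_pow, h1]
  rw [sum_comm]
  simp only [AddChar.sum_apply_eq_ite, sub_eq_zero]
  rw [← sum_filter, sum_const, nsmul_eq_mul, mul_comm]

/-- If all nontrivial Fourier coefficients of the push-forward of the counting measure under `b` are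
small, and `P + b` lies in a set `Q` not much larger than `P`, then `Q + Q` is everything. -/
theorem exists_add_eq_of_fourier_small [Finite V] {I : Type*} [Fintype I] [Nonempty I] (b : I → V)
    (P Q : Finset V) (hP : P.Nonempty) (q : ℝ) (hq : 0 < q)
    (hb : ∀ ψ : AddChar V ℂ, ψ ≠ 0 → q * ‖∑ i, ψ (b i)‖ ≤ Fintype.card I)
    (hQ : ∀ x ∈ P, ∀ i, x + b i ∈ Q) (hsmall : 2 * (#Q : ℝ) < q ^ 2 * #P) (v : V) :
    ∃ q₁ ∈ Q, ∃ q₂ ∈ Q, v = q₁ + q₂ := by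
  classical
  have := Fintype.ofFinite V
  by_contra hcon
  have hhalf : 2 * #Q ≤ Fintype.card V := by
    by_contra! hlt
    refine hcon (exists_add_eq_of_card_lt_two_mul ⊤ Q (fun _ _ => AddSubgroup.mem_top _) ?_
      (AddSubgroup.mem_top v))
    rwa [AddSubgroup.card_top, Nat.card_eq_fintype_card]
  set s := P ×ˢ (univ : Finset I)
  set f : V × I → V := fun x => x.1 + b x.2
  set c : ℝ := Nat.cast #((s ×ˢ s).filter fun x => f x.1 = f x.2)
  set n : ℝ := Nat.cast (Fintype.card I)
  have hn : 0 < n := by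
    simp only [n]
    exact_mod_cast Fintype.card_pos
  have hPpos : (0 : ℝ) < #P := by exact_mod_cast hP.card_pos
  set N : ℝ := Nat.cast (Fintype.card V)
  have hN : 0 < N := by
    simp only [N]
    exact_mod_cast Fintype.card_pos
  have h1 : ((#P : ℝ) * n) ^ 2 ≤ #Q * c := by
    have h := card_sq_le_card_image_mul_collisions s f
    have hs : #s = #P * Fintype.card I := by simp [s]
    have himg : #(s.image f) ≤ #Q := by
      refine card_le_card fun x hx => ?_
      obtain ⟨⟨y, i⟩, hy, rfl⟩ := mem_image.1 hx
      exact hQ y (mem_product.1 hy).1 i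
    rw [hs] at h
    have h' := h.trans (Nat.mul_le_mul_right _ himg)
    simp only [n, c]
    exact_mod_cast h'
  -- In Parseval's identity the trivial character gives the main term. The remaining characters are
  -- bounded by the hypothesis on `b` together with Parseval for `P` alone.
  have h2 : N * c ≤ ((#P : ℝ) * n) ^ 2 + (n / q) ^ 2 * (N * #P) := by
    have hpar := card_mul_collisions_eq_sum_norm_sq s f
    have hparP : N * #P = ∑ ψ : AddChar V ℂ, ‖∑ x ∈ P, ψ x‖ ^ 2 := by
      have h := card_mul_collisions_eq_sum_norm_sq P (fun x => x)
      rw [← h]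
      congr 2
      refine card_bij (fun x _ => (x, x)) (by simp) (by simp) ?_
      rintro ⟨x, y⟩ hxy
      simp only [mem_filter, mem_product] at hxy
      obtain ⟨⟨hx, -⟩, rfl⟩ := hxy
      exact ⟨x, hx, rfl⟩
    have hfac : ∀ ψ : AddChar V ℂ, ‖∑ x ∈ s, ψ (f x)‖ = ‖∑ x ∈ P, ψ x‖ * ‖∑ i, ψ (b i)‖ := by
      intro ψ
      rw [← norm_mul, sum_mul_sum, sum_product]
      simp only [f, AddChar.map_add_eq_mul]
    change N * c = _ at hpar
    rw [hpar, hparP, mul_sum, ← add_sum_erase _ _ (mem_univ (0 : AddChar V ℂ))]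
    refine add_le_add ?_ ?_
    · rw [hfac]
      simp [n]
    · refine (sum_le_sum (g := fun ψ => (n / q) ^ 2 * ‖∑ x ∈ P, ψ x‖ ^ 2) fun ψ hψ => ?_).trans
        (sum_le_sum_of_subset_of_nonneg (erase_subset _ _) fun _ _ _ => by positivity)
      rw [hfac, mul_pow, mul_comm]
      have := hb ψ (ne_of_mem_erase hψ)
      have h' : ‖∑ i, ψ (b i)‖ ≤ n / q := by
        rw [le_div_iff₀ hq, mul_comm]
        exact this
      gcongr
  have hhalf' : 2 * (#Q : ℝ) ≤ N := by
    simp only [N]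
    exact_mod_cast hhalf
  set Qc : ℝ := Nat.cast #Q
  set Pc : ℝ := Nat.cast #P
  have hQpos : 0 < Qc := by
    have : 0 < Qc * c := lt_of_lt_of_le (by positivity) h1
    have hc : 0 ≤ c := by simp only [c]; positivity
    have hQ0 : 0 ≤ Qc := by simp only [Qc]; positivity
    rcases hQ0.lt_or_eq with h | h
    · exact h
    · rw [← h] at this
      simp at this
  have h3 : N * (Pc * n) ^ 2 ≤ Qc * ((Pc * n) ^ 2 + (n / q) ^ 2 * (N * Pc)) := by
    calc N * (Pc * n) ^ 2 ≤ N * (Qc * c) := by gcongr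
      _ = Qc * (N * c) := by ring
      _ ≤ _ := by gcongr
  have h4 : N * Pc ≤ Qc * (Pc + N / q ^ 2) := by
    have hpos : 0 < Pc * n ^ 2 := by positivity
    refine le_of_mul_le_mul_right ?_ hpos
    calc N * Pc * (Pc * n ^ 2) = N * (Pc * n) ^ 2 := by ring
      _ ≤ _ := h3
      _ = _ := by field_simp
  have h5 : 2 * Qc * Pc ≤ N * Pc := by gcongr
  have h6 : 2 * Qc * (N / q ^ 2) < N * Pc := by
    calc 2 * Qc * (N / q ^ 2) < q ^ 2 * Pc * (N / q ^ 2) := by gcongr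
      _ = N * Pc := by field_simp
  linarith

end Fourier

/-! ### Layered groups and coprime action -/

section Commutators

variable {G : Type*} [Group G]

lemma Subgroup.commutator_le_iff_map_le_centralizer {N : Subgroup G} [N.Normal]
    {H K : Subgroup G} :
    ⁅H, K⁆ ≤ N ↔ H.map (QuotientGroup.mk' N) ≤
      Subgroup.centralizer (K.map (QuotientGroup.mk' N) : Set (G ⧸ N)) := by
  rw [← Subgroup.commutator_eq_bot_iff_le_centralizer, ← Subgroup.map_commutator,
    Subgroup.map_eq_bot_iff, QuotientGroup.ker_mk']

lemma Subgroup.sup_commutator_le {N : Subgroup G} [N.Normal] {H₁ H₂ K : Subgroup G}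
    (h₁ : ⁅H₁, K⁆ ≤ N) (h₂ : ⁅H₂, K⁆ ≤ N) : ⁅H₁ ⊔ H₂, K⁆ ≤ N := by
  rw [Subgroup.commutator_le_iff_map_le_centralizer] at *
  rw [Subgroup.map_sup]
  exact sup_le h₁ h₂

lemma Subgroup.commutator_sup_le {N : Subgroup G} [N.Normal] {H K₁ K₂ : Subgroup G}
    (h₁ : ⁅H, K₁⁆ ≤ N) (h₂ : ⁅H, K₂⁆ ≤ N) : ⁅H, K₁ ⊔ K₂⁆ ≤ N := by
  rw [Subgroup.commutator_comm] at *
  exact Subgroup.sup_commutator_le h₁ h₂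

/-- If the order of `x` is prime to `n` and `x ^ n` lies in a subgroup, so does `x`. -/
lemma Subgroup.mem_of_pow_mem_of_coprime {N : Subgroup G} {x : G} {n : ℕ}
    (h : n.Coprime (orderOf x)) (hx : x ^ n ∈ N) : x ∈ N := by
  obtain ⟨m, hm⟩ := exists_pow_eq_self_of_coprime h
  rw [← hm]
  exact N.pow_mem hx m

/-- The elements of `G` acting trivially on `X / Y` by conjugation. -/
def layerKernel (X Y : Subgroup G) (hX : X.Normal) : Subgroup G where
  carrier := {g | ∀ x ∈ X, ⁅g, x⁆ ∈ Y}
  one_mem' := by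
    intro x _
    simp [Y.one_mem]
  mul_mem' := by
    intro a b ha hb x hx
    have h1 := ha _ (hX.conj_mem x hx b)
    have h2 := Y.mul_mem h1 (hb x hx)
    simpa [commutatorElement_def, mul_assoc] using h2
  inv_mem' := by
    intro a ha x hx
    have h1 := Y.inv_mem (ha _ (hX.conj_mem x hx a⁻¹))
    simpa [commutatorElement_def, mul_assoc] using h1

end Commutators

/-- A finite group `G = U 0 ⊔ T` with `U 0` normal and `T` abelian, of coprime orders, together with
a normal central series `U 0 ≥ U 1 ≥ ⋯ ≥ U L = 1` of `U 0`, on each layer of which every element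
of `G` acts either trivially or without nontrivial fixed points. -/
structure IsLayered {G : Type*} [Group G] (L : ℕ) (U : ℕ → Subgroup G) (T : Subgroup G) :
    Prop where
  normal : ∀ i, (U i).Normal
  antitone : Antitone U
  eq_bot : U L = ⊥
  commutator_le : ∀ i, ⁅U i, U 0⁆ ≤ U (i + 1)
  sup_eq_top : U 0 ⊔ T = ⊤
  comm : ∀ s ∈ T, ∀ t ∈ T, s * t = t * s
  coprime : (Nat.card (U 0)).Coprime (Nat.card T)
  semiregular : ∀ (i : ℕ) (g : G), (∀ x ∈ U i, ⁅g, x⁆ ∈ U (i + 1)) ∨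
    (∀ x ∈ U i, ⁅g, x⁆ ∈ U (i + 1) → x ∈ U (i + 1))

/-- A fixed-point-free automorphism of a finite abelian section stays fixed-point-free on every
invariant quotient. -/
lemma mem_sup_of_commutator_mem {G : Type*} [Group G] [Finite G] {X Y : Subgroup G}
    (hY : Y.Normal) (hXY : ⁅X, X⁆ ≤ Y) {g : G} (hX : ∀ x ∈ X, g * x * g⁻¹ ∈ X)
    (hg : ∀ x ∈ X, ⁅g, x⁆ ∈ Y → x ∈ Y) {S : Subgroup G} (hSX : S ≤ X)
    (hgS : ∀ s ∈ S, g * s * g⁻¹ ∈ S) {x : G} (hx : x ∈ X) (hgx : ⁅g, x⁆ ∈ S ⊔ Y) :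
    x ∈ S ⊔ Y := by
  set π := QuotientGroup.mk' Y
  let f : G ⧸ Y → G ⧸ Y := fun y => ⁅π g, y⁆
  have hcomm : ∀ x ∈ X, ∀ y ∈ X, π x * π y = π y * π x := by
    intro x hx y hy
    rw [← commutatorElement_eq_one_iff_mul_comm, ← map_commutatorElement]
    exact (QuotientGroup.eq_one_iff _).2 (hXY (Subgroup.commutator_mem_commutator hx hy))
  have hinj : Set.InjOn f (X.map π) := by
    rintro _ ⟨a, ha, rfl⟩ _ ⟨b, hb, rfl⟩ hab
    simp only [f, commutatorElement_def] at hab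
    have h1 : π (b⁻¹ * a) = 1 := by
      refine (QuotientGroup.eq_one_iff _).2 (hg _ (X.mul_mem (X.inv_mem hb) ha) ?_)
      refine (QuotientGroup.eq_one_iff _).1 ?_
      change π _ = 1
      have h2 := hcomm _ (hX a ha) _ (X.inv_mem ha)
      have h3 := hcomm _ (hX b hb) _ (X.inv_mem hb)
      simp only [map_mul, map_inv] at h2 h3
      rw [h2, h3] at hab
      have h4 : (π g * π b * (π g)⁻¹)⁻¹ * (π g * π a * (π g)⁻¹) = (π b)⁻¹ * π a := by
        have h5 : π g * π a * (π g)⁻¹ = π a * ((π b)⁻¹ * (π g * π b * (π g)⁻¹)) := by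
          rw [← hab]
          group
        have h6 := hcomm _ (X.mul_mem ha (X.inv_mem hb)) _ (hX b hb)
        simp only [map_mul, map_inv] at h6
        have h7 := hcomm _ ha _ (X.inv_mem hb)
        simp only [map_inv] at h7
        rw [h5, ← mul_assoc (π a), h6, inv_mul_cancel_left, h7]
      simp only [commutatorElement_def, map_mul, map_inv]
      calc _ = (π g * π b * (π g)⁻¹)⁻¹ * (π g * π a * (π g)⁻¹) * ((π b)⁻¹ * π a)⁻¹ := by group
        _ = 1 := by rw [h4, mul_inv_cancel]
    rw [map_mul, map_inv, inv_mul_eq_one] at h1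
    exact h1.symm
  have hmaps : Set.MapsTo f (S.map π) (S.map π) := by
    rintro _ ⟨s, hs, rfl⟩
    refine ⟨⁅g, s⁆, ?_, map_commutatorElement π _ _⟩
    rw [commutatorElement_def]
    exact S.mul_mem (hgS s hs) (S.inv_mem hs)
  have hsub : (S.map π : Set (G ⧸ Y)) ⊆ X.map π := Subgroup.map_mono hSX
  -- An injective self-map of the finite image of `S` is onto, so the value of `f` at `x` is already
  -- attained there; injectivity on `X / Y` then places `x` in `S` modulo `Y`.
  have hsurj : Set.SurjOn f (S.map π) (S.map π) := by
    have : f '' (S.map π) = S.map π :=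
      Set.eq_of_subset_of_ncard_le hmaps.image_subset
        (by rw [(hinj.mono hsub).ncard_image]) (Set.toFinite _)
    exact this.ge
  have hπx : ∀ z, z ∈ S ⊔ Y ↔ π z ∈ S.map π := by
    intro z
    rw [← Subgroup.mem_comap, Subgroup.comap_map_eq, QuotientGroup.ker_mk']
  rw [hπx, map_commutatorElement] at hgx
  obtain ⟨y, hy, hyx⟩ := hsurj hgx
  rw [hπx, ← hinj (hsub hy) (Subgroup.mem_map_of_mem π hx) hyx]
  exact hy

namespace IsLayered

variable {G : Type*} [Group G] {L : ℕ} {U : ℕ → Subgroup G} {T : Subgroup G}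

lemma exists_mul_eq (h : IsLayered L U T) (g : G) : ∃ u ∈ U 0, ∃ t ∈ T, g = u * t := by
  have := h.normal 0
  have hg : g ∈ U 0 ⊔ T := h.sup_eq_top ▸ Subgroup.mem_top g
  rw [Subgroup.mem_sup_of_normal_left] at hg
  obtain ⟨u, hu, t, ht, rfl⟩ := hg
  exact ⟨u, hu, t, ht, rfl⟩

lemma zero_le_layerKernel (h : IsLayered L U T) (i : ℕ) :
    U 0 ≤ layerKernel (U i) (U (i + 1)) (h.normal i) := by
  intro u hu x hx
  rw [← commutatorElement_inv]
  exact inv_mem (h.commutator_le i (Subgroup.commutator_mem_commutator hx hu))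

lemma mem_sup (h : IsLayered L U T) [Finite G] {i : ℕ} {g : G}
    (hg : ∀ x ∈ U i, ⁅g, x⁆ ∈ U (i + 1) → x ∈ U (i + 1)) {S : Subgroup G} (hS : S ≤ U i)
    (hgS : ∀ s ∈ S, g * s * g⁻¹ ∈ S) {x : G} (hx : x ∈ U i) (hgx : ⁅g, x⁆ ∈ S ⊔ U (i + 1)) :
    x ∈ S ⊔ U (i + 1) :=
  mem_sup_of_commutator_mem (h.normal _)
    ((Subgroup.commutator_mono le_rfl (h.antitone (Nat.zero_le i))).trans (h.commutator_le i))
    (fun x hx => (h.normal i).conj_mem x hx g) hg hS hgS hx hgx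

/-- An element acting without fixed points on a layer does so on the image of this layer. -/
lemma map_fixedPointFree (h : IsLayered L U T) [Finite G] {H : Type*} [Group H] (π : G →* H)
    {i : ℕ} {g : G} (hg : ∀ x ∈ U i, ⁅g, x⁆ ∈ U (i + 1) → x ∈ U (i + 1)) :
    ∀ x ∈ (U i).map π, ⁅π g, x⁆ ∈ (U (i + 1)).map π → x ∈ (U (i + 1)).map π := by
  rintro _ ⟨x, hx, rfl⟩ hgx
  rw [← map_commutatorElement] at hgx
  obtain ⟨u, hu, hux⟩ := hgx
  have hgxi : ⁅g, x⁆ ∈ U i := by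
    rw [commutatorElement_def]
    exact (U i).mul_mem ((h.normal i).conj_mem x hx g) ((U i).inv_mem hx)
  have hker : ⁅g, x⁆ * u⁻¹ ∈ π.ker ⊓ U i := by
    refine ⟨?_, (U i).mul_mem hgxi ((U i).inv_mem (h.antitone (Nat.le_succ i) hu))⟩
    change π _ = 1
    rw [map_mul, map_inv, hux, mul_inv_cancel]
  have hmem : ⁅g, x⁆ ∈ (π.ker ⊓ U i) ⊔ U (i + 1) := by
    have := Subgroup.mul_mem_sup hker hu
    rwa [inv_mul_cancel_right] at this
  have hx' := h.mem_sup hg inf_le_right (fun s hs =>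
    ⟨(MonoidHom.normal_ker π).conj_mem s hs.1 g, (h.normal i).conj_mem s hs.2 g⟩) hx hmem
  have := h.normal (i + 1)
  rw [Subgroup.mem_sup_of_normal_right] at hx'
  obtain ⟨k, hk, v, hv, rfl⟩ := hx'
  refine ⟨v, hv, ?_⟩
  rw [map_mul, (MonoidHom.mem_ker).1 hk.1, one_mul]

/-- The image of a layered group under a surjective homomorphism is layered. -/
lemma map (h : IsLayered L U T) [Finite G] {H : Type*} [Group H] (π : G →* H)
    (hπ : Function.Surjective π) : IsLayered L (fun i => (U i).map π) (T.map π) where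
  normal i := (h.normal i).map π hπ
  antitone i j hij := Subgroup.map_mono (h.antitone hij)
  eq_bot := by rw [h.eq_bot, Subgroup.map_bot]
  commutator_le i := by
    rw [← Subgroup.map_commutator]
    exact Subgroup.map_mono (h.commutator_le i)
  sup_eq_top := by
    rw [← Subgroup.map_sup, h.sup_eq_top, Subgroup.map_top_of_surjective π hπ]
  comm := by
    rintro _ ⟨s, hs, rfl⟩ _ ⟨t, ht, rfl⟩
    rw [← map_mul, h.comm s hs t ht, map_mul]
  coprime := (h.coprime.coprime_dvd_left (Subgroup.card_map_dvd _ π)).coprime_dvd_right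
    (Subgroup.card_map_dvd _ π)
  semiregular i g := by
    obtain ⟨g, rfl⟩ := hπ g
    rcases h.semiregular i g with hg | hg
    · left
      rintro _ ⟨x, hx, rfl⟩
      rw [← map_commutatorElement]
      exact Subgroup.mem_map_of_mem π (hg x hx)
    · right
      exact h.map_fixedPointFree π hg

lemma commutator_normal (h : IsLayered L U T) : (⁅U 0, T⁆).Normal := by
  rw [← Subgroup.normalizer_eq_top_iff, eq_top_iff, ← h.sup_eq_top]
  exact sup_le (Subgroup.normalizer_commutator_ge_left _ _)
    (Subgroup.normalizer_commutator_ge_right _ _)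

lemma commutator_le_zero (h : IsLayered L U T) : ⁅U 0, T⁆ ≤ U 0 := by
  have := h.normal 0
  exact Subgroup.commutator_le_left _ _

/-- Modulo `⁅U 0, T⁆` the abelian group `T` is centralized by `U 0` and by itself, so its image is
central. This normal subgroup serves as a substitute for `T`, which need not be normal. -/
lemma sup_normal (h : IsLayered L U T) : (⁅U 0, T⁆ ⊔ T).Normal := by
  have hD := h.commutator_normal
  rw [← Subgroup.normalizer_eq_top_iff, eq_top_iff, ← h.sup_eq_top,
    Subgroup.le_normalizer_iff_commutator_le_left]
  refine Subgroup.commutator_le.2 fun x hx g hg => ?_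
  obtain ⟨u, hu, t, ht, rfl⟩ := h.exists_mul_eq g
  rw [Subgroup.mem_sup_of_normal_left] at hx
  obtain ⟨d, hd, s, hs, rfl⟩ := hx
  have hds : ⁅d * s, u * t⁆ = ⁅d, u * t⁆ * (u * t * d * (u * t)⁻¹ ) * ⁅s, u * t⁆ *
    (u * t * d * (u * t)⁻¹)⁻¹ := by
    simp only [commutatorElement_def]; group
  have e : ⁅s, u * t⁆ = ⁅s, u⁆ := by
    have : s * t = t * s := h.comm s hs t ht
    have h2 : s * t * s⁻¹ * t⁻¹ = 1 := by rw [this]; group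
    calc ⁅s, u * t⁆ = s * u * s⁻¹ * (s * t * s⁻¹ * t⁻¹) * u⁻¹ := by
          simp only [commutatorElement_def]; group
      _ = ⁅s, u⁆ := by rw [h2, commutatorElement_def]; group
  have h1 : ⁅d, u * t⁆ ∈ ⁅U 0, T⁆ := by
    rw [commutatorElement_def, mul_assoc, mul_assoc]
    exact mul_mem hd (by simpa [mul_assoc] using hD.conj_mem _ (inv_mem hd) (u * t))
  have h2 := hD.conj_mem _ hd (u * t)
  have h3 : ⁅s, u⁆ ∈ ⁅U 0, T⁆ := by
    rw [← commutatorElement_inv]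
    exact inv_mem (Subgroup.commutator_mem_commutator hu hs)
  rw [hds, e]
  exact Subgroup.mem_sup_left (mul_mem (mul_mem (mul_mem h1 h2) h3) (inv_mem h2))

lemma coprime_orderOf (h : IsLayered L U T) [Finite G] {x : G} (hx : x ∈ U 0) :
    (Nat.card T).Coprime (orderOf x) := by
  refine (h.coprime.coprime_dvd_left ?_).symm
  exact Subgroup.orderOf_dvd_natCard _ hx

/-- Coprime action: `[U 0, T]` is its own commutator with `[U 0, T] T`. -/
lemma le_commutator (h : IsLayered L U T) [Finite G] :
    ⁅U 0, T⁆ ≤ ⁅⁅U 0, T⁆, ⁅U 0, T⁆ ⊔ T⁆ := by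
  have hD := h.commutator_normal
  have hO := h.sup_normal
  set X := ⁅⁅U 0, T⁆, ⁅U 0, T⁆ ⊔ T⁆ with hX
  refine Subgroup.commutator_le.2 fun u hu t ht => ?_
  have hd : ⁅t, u⁆ ∈ ⁅U 0, T⁆ := by
    rw [← commutatorElement_inv]
    exact inv_mem (Subgroup.commutator_mem_commutator hu ht)
  suffices hs : ⁅t, u⁆ ∈ X by
    rw [← commutatorElement_inv]
    exact inv_mem hs
  refine Subgroup.mem_of_pow_mem_of_coprime (h.coprime_orderOf (h.commutator_le_zero hd)) ?_
  -- Modulo `X` the element t commutes with d = [t, u], so conjugating u by t^k gives d^k u. Taking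
  -- k = |T| yields d^|T| ∈ X, and the order of d is prime to |T|.
  set π := QuotientGroup.mk' X
  have hcomm : π t * π ⁅t, u⁆ = π ⁅t, u⁆ * π t := by
    rw [eq_comm, ← commutatorElement_eq_one_iff_mul_comm, ← map_commutatorElement]
    exact (QuotientGroup.eq_one_iff _).2 (Subgroup.commutator_mem_commutator hd
      (Subgroup.mem_sup_right ht))
  have hpow : ∀ k : ℕ, π t ^ k * π u * (π t ^ k)⁻¹ = π ⁅t, u⁆ ^ k * π u := by
    intro k
    induction k with
    | zero => simp
    | succ k ih =>
      have e1 : π t ^ (k + 1) * π u * (π t ^ (k + 1))⁻¹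
          = π t * (π t ^ k * π u * (π t ^ k)⁻¹) * (π t)⁻¹ := by
        rw [pow_succ']; group
      have e2 : π t * π ⁅t, u⁆ ^ k = π ⁅t, u⁆ ^ k * π t := (Commute.pow_right hcomm k)
      have e3 : π t * π u * (π t)⁻¹ = π ⁅t, u⁆ * π u := by
        rw [map_commutatorElement, commutatorElement_def]; group
      rw [e1, ih, ← mul_assoc, e2, mul_assoc (π ⁅t, u⁆ ^ k), mul_assoc (π ⁅t, u⁆ ^ k), e3,
        ← mul_assoc, pow_succ]
  have hone : π t ^ Nat.card T = 1 := by
    rw [← map_pow]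
    have : t ^ Nat.card T = 1 := 
      congrArg Subtype.val (pow_card_eq_one' (x := (⟨t, ht⟩ : T)))
    rw [this, map_one]
  have hfin := hpow (Nat.card T)
  rw [hone] at hfin
  refine (QuotientGroup.eq_one_iff _).1 ?_
  change π _ = 1
  rw [map_pow]
  have : π u = π ⁅t, u⁆ ^ Nat.card T * π u := by simpa using hfin
  exact right_eq_mul.1 this

lemma commutator_le_lowerCentralSeries (h : IsLayered L U T) [Finite G] (j : ℕ) :
    ⁅U 0, T⁆ ≤ (⊤ : Subgroup G).lowerCentralSeries j := by
  induction j with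
  | zero => exact le_top
  | succ j ih => exact h.le_commutator.trans (Subgroup.commutator_mono ih le_top)

/-- If `V` is a normal central series of `U 0`, then the lower central series of `G` is contained
in `V` up to `[U 0, T]`. -/
lemma lowerCentralSeries_le (h : IsLayered L U T) (V : ℕ → Subgroup G) (hV : ∀ j, (V j).Normal)
    (hV0 : V 0 = U 0) (hVle : ∀ j, V j ≤ U 0) (hVc : ∀ j, ⁅V j, U 0⁆ ≤ V (j + 1)) (j : ℕ) :
    (⊤ : Subgroup G).lowerCentralSeries (j + 1) ≤ V (j + 1) ⊔ ⁅U 0, T⁆ := by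
  have hD := h.commutator_normal
  have hTT : ⁅T, T⁆ = ⊥ := by
    rw [eq_bot_iff]
    refine Subgroup.commutator_le.2 fun s hs t ht => ?_
    rw [Subgroup.mem_bot, commutatorElement_eq_one_iff_mul_comm]
    exact h.comm s hs t ht
  induction j with
  | zero =>
    have := hV 1
    rw [Subgroup.lowerCentralSeries_succ, Subgroup.lowerCentralSeries_zero, ← h.sup_eq_top]
    refine Subgroup.sup_commutator_le (Subgroup.commutator_sup_le ?_ ?_)
      (Subgroup.commutator_sup_le ?_ ?_)
    · exact (hV0 ▸ hVc 0).trans le_sup_left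
    · exact le_sup_right
    · rw [Subgroup.commutator_comm]
      exact le_sup_right
    · rw [hTT]
      exact bot_le
  | succ j ih =>
    have := hV (j + 2)
    rw [Subgroup.lowerCentralSeries_succ]
    refine (Subgroup.commutator_mono ih le_rfl).trans (Subgroup.sup_commutator_le ?_ ?_)
    · rw [← h.sup_eq_top]
      refine Subgroup.commutator_sup_le ((hVc (j + 1)).trans le_sup_left) ?_
      exact (Subgroup.commutator_mono (hVle _) le_rfl).trans le_sup_right
    · exact (Subgroup.commutator_le_left _ _).trans le_sup_right

/-- Being a term of the lower central series with index bounded in terms of `L` is what makes `⁅U 0,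
T⁆` normally generated by commutators of bounded length in the generators. -/
lemma lowerCentralSeries_eq (h : IsLayered L U T) [Finite G] :
    (⊤ : Subgroup G).lowerCentralSeries (L + 1) = ⁅U 0, T⁆ := by
  refine le_antisymm ?_ (h.commutator_le_lowerCentralSeries _)
  have h1 := h.lowerCentralSeries_le U h.normal rfl (fun j => h.antitone (Nat.zero_le j))
    h.commutator_le L
  have h2 : U (L + 1) = ⊥ := by
    rw [eq_bot_iff, ← h.eq_bot]
    exact h.antitone (Nat.le_succ L)
  rwa [h2, bot_sup_eq] at h1

end IsLayered

/-- Let `f` be a homomorphism from a normal subgroup `M` to an abelian group, invariant under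
conjugation by `D`. By a norm argument over `T`, an element of `[M, D T]` whose image is fixed by
`T` is killed by `|T|`. -/
lemma pow_card_eq_one_of_fixed {G : Type*} [Group G] {M D T : Subgroup G} [Finite T] [M.Normal]
    [D.Normal] {C : Type*} [CommGroup C] (f : M →* C)
    (hf : ∀ d ∈ D, ∀ m : M, f (MulAut.conjNormal d m) = f m) {x : M}
    (hx : (x : G) ∈ ⁅M, D ⊔ T⁆) (hfix : ∀ t ∈ T, f (MulAut.conjNormal t x) = f x) :
    f x ^ Nat.card T = 1 := by
  have := Fintype.ofFinite T
  -- The norm of `f` over `T`. It is unchanged by conjugation by `D ⊔ T`, since `D` is absorbed by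
  -- `hf` and `T` permutes the factors. So it kills `⁅M, D ⊔ T⁆`, while at an element whose image is
  -- `T`-fixed it equals f(x)^|T|.
  let ν : M →* C := ∏ t : T, f.comp (MulAut.conjNormal (t : G) : MulAut M).toMonoidHom
  have hν : ∀ m, ν m = ∏ t : T, f (MulAut.conjNormal (t : G) m) := by
    intro m
    simp [ν, MonoidHom.finsetProd_apply]
  have hνo : ∀ o ∈ D ⊔ T, ∀ m, ν (MulAut.conjNormal o m) = ν m := by
    intro o ho m
    rw [Subgroup.mem_sup_of_normal_left] at ho
    obtain ⟨d, hd, t, ht, rfl⟩ := ho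
    rw [hν, hν]
    refine Fintype.prod_equiv (Equiv.mulRight (⟨t, ht⟩ : T)) _ _ fun s => ?_
    have hd' : (s : G) * d * (s : G)⁻¹ ∈ D := Subgroup.Normal.conj_mem inferInstance d hd s
    have e : (s : G) * (d * t) = ((s : G) * d * (s : G)⁻¹) * (s * t) := by group
    rw [← MulAut.mul_apply, ← map_mul, e, map_mul, MulAut.mul_apply, hf _ hd']
    rfl
  have hle : ⁅M, D ⊔ T⁆ ≤ ν.ker.map M.subtype := by
    refine Subgroup.commutator_le.2 fun m hm o ho => ?_
    refine ⟨⟨m, hm⟩ * MulAut.conjNormal o ⟨m, hm⟩⁻¹, ?_, ?_⟩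
    · rw [SetLike.mem_coe, MonoidHom.mem_ker, map_mul, hνo o ho, map_inv, mul_inv_cancel]
    · simp [commutatorElement_def, mul_assoc]
  obtain ⟨y, hy, hyx⟩ := hle hx
  have hyx' : y = x := Subtype.ext hyx
  subst hyx'
  have h1 : ν y = 1 := hy
  rw [hν, Finset.prod_congr rfl (fun (t : T) _ => hfix t t.2)] at h1
  simpa [Nat.card_eq_fintype_card] using h1

lemma Set.ncard_image_le_of_forall {α β γ : Type*} {f : α → β} {g : α → γ} {s : Set α}
    (hs : s.Finite) (h : ∀ a ∈ s, ∀ b ∈ s, g a = g b → f a = f b) :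
    (f '' s).ncard ≤ (g '' s).ncard := by
  classical
  rcases s.eq_empty_or_nonempty with rfl | ⟨a₀, _⟩
  · simp
  have : Nonempty α := ⟨a₀⟩
  have : f '' s = (fun c => f (Function.invFunOn g s c)) '' (g '' s) := by
    rw [Set.image_image]
    refine Set.image_congr fun a ha => ?_
    have hex : ∃ b ∈ s, g b = g a := ⟨a, ha, rfl⟩
    exact (h _ (Function.invFunOn_mem hex) a ha (Function.invFunOn_eq hex)).symm
  rw [this]
  exact Set.ncard_image_le (hs.image g)

/-! ### Growth of generating sets and their words -/

/-- The word length of a `j`-fold commutator. -/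
def commutatorLength : ℕ → ℕ
  | 0 => 1
  | j + 1 => 2 * commutatorLength j + 2

open Finset in
lemma mul_mem_pow_add {G : Type*} [Group G] [DecidableEq G] {A : Finset G} {x y : G} {j k : ℕ}
    (hx : x ∈ A ^ j) (hy : y ∈ A ^ k) : x * y ∈ A ^ (j + k) := by
  rw [pow_add]
  exact Finset.mul_mem_mul hx hy

lemma inv_mem_pow {G : Type*} [Group G] [DecidableEq G] {A : Finset G} (hA : A⁻¹ = A) {x : G}
    {j : ℕ} (hx : x ∈ A ^ j) : x⁻¹ ∈ A ^ j := by
  rw [← hA, inv_pow]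
  exact Finset.inv_mem_inv hx

/-- The terms of the lower central series are normally generated by iterated commutators of
generators. -/
lemma lowerCentralSeries_le_normalClosure {G : Type*} [Group G] [DecidableEq G] {A : Finset G}
    (hA : A⁻¹ = A) (hgen : Subgroup.closure (A : Set G) = ⊤) (j : ℕ) :
    ∃ S : Set G, S ⊆ (A ^ commutatorLength j : Finset G) ∧
      Subgroup.normalClosure S = (⊤ : Subgroup G).lowerCentralSeries j := by
  induction j with
  | zero =>
    refine ⟨A, by simp [commutatorLength], ?_⟩
    rw [Subgroup.lowerCentralSeries_zero, eq_top_iff, ← hgen]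
    exact Subgroup.closure_le_normalClosure
  | succ j ih =>
    obtain ⟨S, hS, hSj⟩ := ih
    refine ⟨{x | ∃ s ∈ S, ∃ a ∈ A, x = ⁅s, a⁆}, ?_, ?_⟩
    · rintro _ ⟨s, hs, a, ha, rfl⟩
      have hs' := hS hs
      have ha' : a ∈ A ^ 1 := by simpa using ha
      have h1 := mul_mem_pow_add (mul_mem_pow_add (mul_mem_pow_add hs' ha')
        (inv_mem_pow hA hs')) (inv_mem_pow hA ha')
      rw [commutatorElement_def, SetLike.mem_coe]
      convert h1 using 2
      simp only [commutatorLength]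
      ring
    · set N := Subgroup.normalClosure {x | ∃ s ∈ S, ∃ a ∈ A, x = ⁅s, a⁆} with hN
      apply le_antisymm
      · refine Subgroup.normalClosure_le_normal ?_
        rintro _ ⟨s, hs, a, ha, rfl⟩
        refine Subgroup.commutator_mem_commutator ?_ (Subgroup.mem_top a)
        rw [← hSj]
        exact Subgroup.subset_normalClosure hs
      -- Modulo `N` each element of `S` commutes with the generators in `A`, so it is central; hence
      -- so is everything it normally generates.
      · rw [Subgroup.lowerCentralSeries_succ, Subgroup.commutator_le_iff_map_le_centralizer,
          Subgroup.map_top_of_surjective _ (QuotientGroup.mk'_surjective N), Subgroup.coe_top,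
          Subgroup.centralizer_univ, Subgroup.map_le_iff_le_comap, ← hSj]
        refine Subgroup.normalClosure_le_normal fun s hs => ?_
        rw [SetLike.mem_coe, Subgroup.mem_comap, Subgroup.mem_center_iff]
        intro g
        obtain ⟨g, rfl⟩ := QuotientGroup.mk'_surjective N g
        have hcl : Subgroup.closure (A : Set G) ≤
            (Subgroup.centralizer {QuotientGroup.mk' N s}).comap (QuotientGroup.mk' N) := by
          rw [Subgroup.closure_le]
          intro a ha
          rw [SetLike.mem_coe, Subgroup.mem_comap, Subgroup.mem_centralizer_singleton_iff]
          rw [eq_comm, ← commutatorElement_eq_one_iff_mul_comm, ← map_commutatorElement]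
          exact (QuotientGroup.eq_one_iff _).2
            (Subgroup.subset_normalClosure ⟨s, hs, a, ha, rfl⟩)
        have := hcl (hgen ▸ Subgroup.mem_top g)
        rw [Subgroup.mem_comap, Subgroup.mem_centralizer_singleton_iff] at this
        exact this

open Finset in
/-- A symmetric generating set `A` of bounded growth in a layered group, which has more than `R`
images in the automorphism group of each layer with nontrivial action. -/
structure GrowthData {G : Type*} [Group G] [DecidableEq G] (L : ℕ) (U : ℕ → Subgroup G)
    (T : Subgroup G) (A : Finset G) (K R : ℝ) : Prop extends IsLayered L U T where
  inv_eq : A⁻¹ = A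
  one_mem : 1 ∈ A
  closure_eq : Subgroup.closure (A : Set G) = ⊤
  one_le : 1 ≤ K
  growth : ∀ k : ℕ, 1 ≤ k → (#(A ^ k) : ℝ) ≤ K ^ k * #A
  roots : ∀ i : ℕ, (∀ g : G, ∀ x ∈ U i, ⁅g, x⁆ ∈ U (i + 1)) ∨
    R < ((fun g : G => (g : G ⧸ layerKernel (U i) (U (i + 1)) (normal i))) '' A).ncard

namespace GrowthData

open Finset

variable {G : Type*} [Group G] [DecidableEq G] {L : ℕ} {U : ℕ → Subgroup G} {T : Subgroup G}
  {A : Finset G} {K R : ℝ}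

lemma pow_subset (h : GrowthData L U T A K R) {j k : ℕ} (hjk : j ≤ k) : A ^ j ⊆ A ^ k :=
  Finset.pow_subset_pow_right h.one_mem hjk

-- This is orbit counting for the cosets of `Z`: |A/Z||A^k ∩ Z| ≤ |A^(k+1)| ≤ K^(k+1)|A|, whereas
-- |A| ≤ |A/Z||A² ∩ Z|. Small growth of `A` is thereby inherited by its trace on any normal
-- subgroup.
open Classical in
lemma card_pow_inter_le (h : GrowthData L U T A K R) (Z : Subgroup G) [Z.Normal] (k : ℕ) :
    (#{x ∈ A ^ k | x ∈ Z} : ℝ) ≤ K ^ (k + 1) * #{x ∈ A ^ 2 | x ∈ Z} := by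
  have h1 := card_pow_quotient_mul_pow_inter_subgroup_le (A := A) (H := Z) (m := 1) (n := k)
  have h2 := le_card_quotient_mul_sq_inter_subgroup (H := Z) h.inv_eq
  have h3 := h.growth (k + 1) (Nat.le_add_left 1 k)
  rw [pow_one, add_comm 1 k] at h1
  have hpos : 0 < #(A.image (QuotientGroup.mk' Z)) :=
    (Finset.image_nonempty.2 ⟨1, h.one_mem⟩).card_pos
  have hpos' : (0 : ℝ) < #(A.image (QuotientGroup.mk' Z)) := by exact_mod_cast hpos
  have hK : 0 ≤ K := zero_le_one.trans h.one_le
  refine le_of_mul_le_mul_left ?_ hpos'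
  calc (#(A.image (QuotientGroup.mk' Z)) : ℝ) * #{x ∈ A ^ k | x ∈ Z}
      ≤ #(A ^ (k + 1)) := by exact_mod_cast h1
    _ ≤ K ^ (k + 1) * #A := h3
    _ ≤ K ^ (k + 1) * (#(A.image (QuotientGroup.mk' Z)) * #{x ∈ A ^ 2 | x ∈ Z}) := by
        gcongr
        exact_mod_cast h2
    _ = _ := by ring

open Classical in
/-- Growth data pass to quotients. -/
lemma quotient (h : GrowthData L U T A K R) [Finite G] (Y : Subgroup G) [Y.Normal] :
    GrowthData L (fun i => (U i).map (QuotientGroup.mk' Y)) (T.map (QuotientGroup.mk' Y))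
      (A.image (QuotientGroup.mk' Y)) (K ^ 3) R where
  toIsLayered := h.toIsLayered.map _ (QuotientGroup.mk'_surjective Y)
  inv_eq := by
    rw [← Finset.image_inv, h.inv_eq]
  one_mem := Finset.mem_image.2 ⟨1, h.one_mem, map_one _⟩
  closure_eq := by
    rw [Finset.coe_image, ← MonoidHom.map_closure, h.closure_eq,
      Subgroup.map_top_of_surjective _ (QuotientGroup.mk'_surjective Y)]
  one_le := one_le_pow₀ h.one_le
  growth k hk := by
    have h1 := card_pow_quotient_mul_pow_inter_subgroup_le (A := A) (H := Y) (m := k) (n := 2)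
    have h2 := le_card_quotient_mul_sq_inter_subgroup (H := Y) h.inv_eq
    have h3 := h.growth (k + 2) (by omega)
    rw [Finset.image_pow] at h1
    have hpos : 0 < #{x ∈ A ^ 2 | x ∈ Y} :=
      Finset.card_pos.2 ⟨1, Finset.mem_filter.2 ⟨Finset.one_mem_pow h.one_mem, Y.one_mem⟩⟩
    have hpos' : (0 : ℝ) < #{x ∈ A ^ 2 | x ∈ Y} := by exact_mod_cast hpos
    have hK : 0 ≤ K := zero_le_one.trans h.one_le
    refine le_of_mul_le_mul_right ?_ hpos'
    calc (#(A.image (QuotientGroup.mk' Y) ^ k) : ℝ) * #{x ∈ A ^ 2 | x ∈ Y}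
        ≤ #(A ^ (k + 2)) := by exact_mod_cast h1
      _ ≤ K ^ (k + 2) * #A := h3
      -- The cube comes from k + 2 ≤ 3k for k ≥ 1.
      _ ≤ (K ^ 3) ^ k * (#(A.image (QuotientGroup.mk' Y)) * #{x ∈ A ^ 2 | x ∈ Y}) := by
          rw [← pow_mul]
          gcongr
          · exact h.one_le
          · omega
          · exact_mod_cast h2
      _ = _ := by ring
  roots i := by
    rcases h.roots i with hi | hi
    · left
      intro g x hx
      obtain ⟨g, rfl⟩ := QuotientGroup.mk'_surjective Y g
      obtain ⟨x, hx, rfl⟩ := hx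
      rw [← map_commutatorElement]
      exact Subgroup.mem_map_of_mem _ (hi g x hx)
    -- Either the layer collapses in the quotient, or a fixed-point-free element stays
    -- fixed-point-free on a nontrivial layer. In the second case elements of `A` acting differently
    -- upstairs still act differently, so no images are lost.
    · by_cases htriv : ∀ x ∈ (U i).map (QuotientGroup.mk' Y),
          x ∈ (U (i + 1)).map (QuotientGroup.mk' Y)
      · left
        intro g x hx
        have hn := (h.normal (i + 1)).map _ (QuotientGroup.mk'_surjective Y)
        rw [commutatorElement_def]
        exact mul_mem (hn.conj_mem x (htriv x hx) g) (inv_mem (htriv x hx))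
      · right
        refine hi.trans_le ?_
        rw [Finset.coe_image, Set.image_image]
        refine Nat.cast_le.2 (Set.ncard_image_le_of_forall (Finset.finite_toSet A) ?_)
        intro a _ b _ hab
        rw [QuotientGroup.eq] at hab ⊢
        rw [← map_inv, ← map_mul] at hab
        rcases h.semiregular i (a⁻¹ * b) with hg | hg
        · exact hg
        · exact absurd (fun x hx => h.map_fixedPointFree _ hg x hx (hab x hx)) htriv

/-- `[U 0, T]` is normally generated by short words. -/
lemma commutator_le_normalClosure (h : GrowthData L U T A K R) [Finite G] {m : ℕ}
    (hm : commutatorLength (L + 1) ≤ m) {N : Subgroup G} (hN : N.Normal)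
    (hAN : ∀ x ∈ A ^ m, x ∈ ⁅U 0, T⁆ → x ∈ N) : ⁅U 0, T⁆ ≤ N := by
  obtain ⟨S, hS, hS'⟩ := lowerCentralSeries_le_normalClosure h.inv_eq h.closure_eq (L + 1)
  rw [h.lowerCentralSeries_eq] at hS'
  rw [← hS']
  refine Subgroup.normalClosure_le_normal fun s hs => hAN s (h.pow_subset hm (hS hs)) ?_
  rw [← hS']
  exact Subgroup.subset_normalClosure hs

end GrowthData

/-! ### Descent along layers with nontrivial action -/

/-- A subgroup stable under conjugation by a symmetric generating set is normal. -/
lemma Subgroup.normal_of_closure_eq_top {G : Type*} [Group G] {A : Set G} (hA : A⁻¹ = A)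
    (hgen : Subgroup.closure A = ⊤) {N : Subgroup G} (h : ∀ a ∈ A, ∀ x ∈ N, a * x * a⁻¹ ∈ N) :
    N.Normal := by
  rw [← Subgroup.normalizer_eq_top_iff, eq_top_iff, ← hgen, Subgroup.closure_le]
  intro a ha
  rw [SetLike.mem_coe, Subgroup.mem_normalizer_iff]
  refine fun x => ⟨h a ha x, fun hx => ?_⟩
  have ha' : a⁻¹ ∈ A := by rw [← hA]; simpa using ha
  simpa [mul_assoc] using h a⁻¹ ha' _ hx

lemma IsLayered.commutator_mem_zero {G : Type*} [Group G] {L : ℕ} {U : ℕ → Subgroup G}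
    {T : Subgroup G} (h : IsLayered L U T) (a b : G) : ⁅a, b⁆ ∈ U 0 := by
  have := h.normal 0
  have hT : IsMulCommutative T :=
    ⟨⟨fun s t => Subtype.ext (h.comm s s.2 t t.2)⟩⟩
  have h1 := Subgroup.Normal.commutator_le_of_self_sup_commutative_eq_top h.sup_eq_top hT
  exact h1 (Subgroup.commutator_mem_commutator (Subgroup.mem_top a) (Subgroup.mem_top b))

namespace GrowthData

open Finset

variable {G : Type*} [Group G] [DecidableEq G] {L : ℕ} {U : ℕ → Subgroup G} {T : Subgroup G}
  {A : Finset G} {K R : ℝ}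

lemma one_mem_pow (h : GrowthData L U T A K R) (k : ℕ) : 1 ∈ A ^ k :=
  Finset.one_mem_pow h.one_mem

lemma conj_mem_pow (h : GrowthData L U T A K R) {a x : G} {k : ℕ} (ha : a ∈ A) (hx : x ∈ A ^ k) :
    a * x * a⁻¹ ∈ A ^ (k + 2) := by
  have ha1 : a ∈ A ^ 1 := by simpa using ha
  have := mul_mem_pow_add (mul_mem_pow_add ha1 hx) (inv_mem_pow h.inv_eq ha1)
  rwa [show 1 + k + 1 = k + 2 by ring] at this

/-- The pivoting argument in a normal subgroup on which `G` acts semiregularly: the normal subgroup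
generated by the words of bounded length in it is covered by words of bounded length. -/
lemma exists_normal_le_pow (h : GrowthData L U T A K R) [Finite G] {Z : Subgroup G} [Z.Normal]
    {i k l : ℕ} (hk : 2 ≤ k) (hl : 12 * k + 40 ≤ l) (hZi : Z ≤ U i)
    (hZ : ∀ z ∈ Z, z ∈ U (i + 1) → z = 1)
    (hfix : ∀ z ∈ Z, (∀ t ∈ T, t * z = z * t) → z = 1) (hR : 2 * K ^ (6 * k + 21) ≤ R) :
    ∃ N : Subgroup G, N.Normal ∧ (∀ x ∈ A ^ k, x ∈ Z → x ∈ N) ∧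
      ∀ x ∈ N, x ∈ A ^ l := by
  classical
  by_cases hbot : ∀ z ∈ Z, z = 1
  · refine ⟨⊥, inferInstance, fun x _ hx => (Subgroup.mem_bot).2 (hbot x hx), fun x hx => ?_⟩
    rw [Subgroup.mem_bot.1 hx]
    exact h.one_mem_pow _
  have hcommZ : ∀ g, ∀ z ∈ Z, ⁅g, z⁆ ∈ U (i + 1) → g * z = z * g := by
    intro g z hz hgz
    rw [← commutatorElement_eq_one_iff_mul_comm]
    refine hZ _ ?_ hgz
    rw [commutatorElement_def]
    exact Z.mul_mem (Subgroup.Normal.conj_mem inferInstance z hz g) (Z.inv_mem hz)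
  have hdich : ∀ g, (∀ z ∈ Z, g * z = z * g) ∨ (∀ z ∈ Z, g * z = z * g → z = 1) := by
    intro g
    rcases h.semiregular i g with hg | hg
    · exact Or.inl fun z hz => hcommZ g z hz (hg z (hZi hz))
    · refine Or.inr fun z hz hgz => hZ z hz (hg z (hZi hz) ?_)
      rw [commutatorElement_eq_one_iff_mul_comm.2 hgz]
      exact Subgroup.one_mem _
  have hU0 : ∀ u ∈ U 0, ∀ z ∈ Z, u * z = z * u := fun u hu z hz =>
    hcommZ u z hz (h.zero_le_layerKernel i hu z (hZi hz))
  let _ : CommGroup Z :=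
    { (inferInstance : Group Z) with
      mul_comm := fun x y =>
        Subtype.ext (hU0 x (h.antitone (Nat.zero_le i) (hZi x.2)) y y.2) }
  let c : G → (Additive Z ≃+ Additive Z) := fun a =>
    MulEquiv.toAdditive (MulAut.conjNormal a : MulAut Z)
  have hc : ∀ a (v : Additive Z), ((c a v).toMul : G) = a * (v.toMul : G) * a⁻¹ := by
    intro a v
    rfl
  have hceq : ∀ a b (v : Additive Z), c a v = c b v ↔
      (b⁻¹ * a) * (v.toMul : G) = (v.toMul : G) * (b⁻¹ * a) := by
    intro a b v
    have : c a v = c b v ↔ ((c a v).toMul : G) = ((c b v).toMul : G) :=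
      ⟨fun h => by rw [h], fun h => Subtype.ext h⟩
    rw [this, hc, hc]
    constructor
    · intro e
      calc b⁻¹ * a * (v.toMul : G) = b⁻¹ * (a * (v.toMul : G) * a⁻¹) * a := by group
        _ = _ := by rw [e]; group
    · intro e
      calc a * (v.toMul : G) * a⁻¹ = b * (b⁻¹ * a * (v.toMul : G)) * a⁻¹ := by group
        _ = _ := by rw [e]; group
  have := Fintype.ofFinite (Additive Z)
  let S : Finset (Additive Z ≃+ Additive Z) := A.image c
  obtain ⟨W, hW⟩ : ∃ W : ℕ → Finset (Additive Z), ∀ j v, v ∈ W j ↔ (v.toMul : G) ∈ A ^ j :=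
    ⟨fun j => univ.filter fun v => (v.toMul : G) ∈ A ^ j, fun j v => by simp⟩
  have hWcard : ∀ j, #(W j) = #{x ∈ A ^ j | x ∈ Z} := by
    intro j
    refine card_bij (fun v _ => (v.toMul : G)) ?_ ?_ ?_
    · intro v hv
      exact mem_filter.2 ⟨(hW j v).1 hv, v.toMul.2⟩
    · intro v _ w _ e
      exact Subtype.ext e
    · intro x hx
      rw [mem_filter] at hx
      exact ⟨Additive.ofMul ⟨x, hx.2⟩, (hW j _).2 hx.1, rfl⟩
  have hWadd : ∀ {j l v w}, v ∈ W j → w ∈ W l → v + w ∈ W (j + l) := by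
    intro j l v w hv hw
    rw [hW] at *
    exact mul_mem_pow_add hv hw
  have hWneg : ∀ {j v}, v ∈ W j → -v ∈ W j := by
    intro j v hv
    rw [hW] at *
    exact inv_mem_pow h.inv_eq hv
  have hWc : ∀ {j v s}, s ∈ S → v ∈ W j → s v ∈ W (j + 2) := by
    intro j v s hs hv
    obtain ⟨a, ha, rfl⟩ := mem_image.1 hs
    rw [hW] at *
    rw [hc]
    exact h.conj_mem_pow ha hv
  -- A trivial action of `G` on the layer would make every element of `Z` fixed by `T`, which `hfix`
  -- excludes when `Z` is nontrivial. By the dichotomy, elements acting alike on `Z` act alike on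
  -- the whole layer.
  have hScard : R < #S := by
    rcases h.roots i with hi | hi
    · exact absurd (fun z hz => hfix z hz fun t _ => hcommZ t z hz (hi t z (hZi hz))) hbot
    · refine hi.trans_le ?_
      have : (#S : ℝ) = (c '' (A : Set G)).ncard := by
        rw [← coe_image, Set.ncard_coe_finset]
      rw [this]
      refine Nat.cast_le.2 (Set.ncard_image_le_of_forall (finite_toSet A) ?_)
      intro a _ b _ hab
      rw [QuotientGroup.eq]
      rcases h.semiregular i (a⁻¹ * b) with hg | hg
      · exact hg
      · refine absurd (fun z hz => hZ z hz (hg z (hZi hz) ?_)) hbot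
        have e : a⁻¹ * b * z = z * (a⁻¹ * b) :=
          (hceq b a (Additive.ofMul ⟨z, hz⟩)).1 (by rw [hab])
        rw [commutatorElement_eq_one_iff_mul_comm.2 e]
        exact Subgroup.one_mem _
  have hKpos : 1 ≤ K ^ (6 * k + 21) := one_le_pow₀ h.one_le
  have hS2 : 2 ≤ #S := by
    have : (2 : ℝ) ≤ #S := by linarith
    exact_mod_cast this
  -- An element of the pivot set has two terms of length k + 2 and four of length k + 4, in total 6k
  -- + 20; `card_pow_inter_le` adds one to the exponent of `K`. The final sum of two such elements
  -- accounts for 12k + 40.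
  have hsmall : 2 * #(W (6 * k + 20)) < #(W k) * #S := by
    have h1 := h.card_pow_inter_le Z (6 * k + 20)
    have h2 : #{x ∈ A ^ 2 | x ∈ Z} ≤ #{x ∈ A ^ k | x ∈ Z} :=
      card_le_card (filter_subset_filter _ (h.pow_subset hk))
    rw [← hWcard, ← hWcard] at h1
    rw [← hWcard, ← hWcard] at h2
    have h2' : (#(W 2) : ℝ) ≤ #(W k) := by exact_mod_cast h2
    have hpos : (0 : ℝ) < #(W k) := by
      have : 0 < #(W k) := card_pos.2 ⟨0, (hW k 0).2 (h.one_mem_pow _)⟩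
      exact_mod_cast this
    have h3 : (2 * #(W (6 * k + 20)) : ℝ) < #(W k) * #S := by
      calc (2 * #(W (6 * k + 20)) : ℝ) ≤ 2 * (K ^ (6 * k + 20 + 1) * #(W k)) := by
            have : K ^ (6 * k + 20 + 1) * (#(W 2) : ℝ) ≤ K ^ (6 * k + 20 + 1) * #(W k) := by
              gcongr
            linarith
        _ = (2 * K ^ (6 * k + 21)) * #(W k) := by ring
        _ ≤ R * #(W k) := by gcongr
        _ < #S * #(W k) := by gcongr
        _ = _ := mul_comm _ _
    exact_mod_cast h3
  obtain ⟨H, hHW, hHS, hHmin⟩ : ∃ H : AddSubgroup (Additive Z), (∀ w ∈ W k, w ∈ H) ∧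
      (∀ s ∈ S, ∀ v ∈ H, s v ∈ H) ∧ ∀ H' : AddSubgroup (Additive Z), (∀ w ∈ W k, w ∈ H') →
        (∀ s ∈ S, ∀ v ∈ H', s v ∈ H') → H ≤ H' :=
    ⟨sInf {H' | (∀ w ∈ W k, w ∈ H') ∧ ∀ s ∈ S, ∀ v ∈ H', s v ∈ H'},
      fun w hw => AddSubgroup.mem_sInf.2 fun H' hH' => hH'.1 w hw,
      fun s hs v hv => AddSubgroup.mem_sInf.2 fun H' hH' =>
        hH'.2 s hs v (AddSubgroup.mem_sInf.1 hv H' hH'),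
      fun H' h1 h2 => sInf_le ⟨h1, h2⟩⟩
  have hH := exists_add_eq_of_pivotSet_small (S := S) (W := W k) (Q := W (6 * k + 20))
    (mem_image.2 ⟨1, h.one_mem, by ext v; simp [c]⟩) hS2
    ((hW k 0).2 (h.one_mem_pow _)) ?_ ?_ ?_ hsmall H hHW hHS hHmin
  · refine ⟨(Subgroup.toAddSubgroup.symm H).map Z.subtype, ?_, ?_, ?_⟩
    · refine Subgroup.normal_of_closure_eq_top (A := (A : Set G)) ?_ h.closure_eq ?_
      · rw [← coe_inv, h.inv_eq]
      · rintro a ha _ ⟨z, hz, rfl⟩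
        exact ⟨_, hHS (c a) (mem_image_of_mem c ha) _ hz, rfl⟩
    · intro x hx hxZ
      exact ⟨⟨x, hxZ⟩, hHW (Additive.ofMul ⟨x, hxZ⟩) ((hW k _).2 hx), rfl⟩
    · rintro _ ⟨z, hz, rfl⟩
      obtain ⟨q₁, hq₁, q₂, hq₂, e⟩ := hH (Additive.ofMul z) hz
      have := (hW _ _).1 (hWadd hq₁ hq₂)
      rw [← e] at this
      exact h.pow_subset (by omega) this
  · intro s hs s' hs' v
    obtain ⟨a, ha, rfl⟩ := mem_image.1 hs
    obtain ⟨b, hb, rfl⟩ := mem_image.1 hs'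
    apply Subtype.ext
    change ((c a (c b v)).toMul : G) = ((c b (c a v)).toMul : G)
    rw [hc, hc, hc, hc]
    -- The automorphisms commute because commutators of `G` lie in `U 0`, which centralizes `Z`.
    have e := hU0 _ (h.commutator_mem_zero a b) _ (Subgroup.Normal.conj_mem
      (inferInstance : Z.Normal) (v.toMul : G) v.toMul.2 (b * a))
    rw [commutatorElement_def] at e
    calc a * (b * (v.toMul : G) * b⁻¹) * a⁻¹
        = a * b * a⁻¹ * b⁻¹ * (b * a * (v.toMul : G) * (b * a)⁻¹) *
          (a * b * a⁻¹ * b⁻¹)⁻¹ := by group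
      _ = _ := by rw [e]; group
  · intro s hs s' hs' hne v hv
    obtain ⟨a, ha, rfl⟩ := mem_image.1 hs
    obtain ⟨b, hb, rfl⟩ := mem_image.1 hs'
    rw [hceq] at hv
    rcases hdich (b⁻¹ * a) with hg | hg
    · refine absurd ?_ hne
      ext w
      rw [(hceq a b w).2 (hg _ w.toMul.2)]
    · exact Subtype.ext (hg _ v.toMul.2 hv)
  · rintro v ⟨s, hs, s', hs', s₁, hs₁, s₂, hs₂, w₀, hw₀, w, hw, w', hw', w'', hw'', rfl⟩
    simp only [sub_eq_add_neg]
    have := hWadd (hWadd (hWadd (hWc hs hw₀) (hWneg (hWc hs' hw₀)))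
      (hWadd (hWc hs₁ (hWc hs₂ hw)) (hWneg (hWc hs₁ (hWc hs₂ hw')))))
      (hWadd (hWc hs (hWc hs₁ hw'')) (hWneg (hWc hs' (hWc hs₁ hw''))))
    convert this using 2
    ring

/-- One step of the descent along a layer with nontrivial action. -/
lemma subset_pow_of_semiregular (h : GrowthData L U T A K R) [Finite G] {Z : Subgroup G}
    [Z.Normal] {i m l : ℕ} (hm : commutatorLength (L + 1) ≤ m) (hm2 : 2 ≤ m)
    (hl : 37 * m + 40 ≤ l) (hZD : Z ≤ ⁅U 0, T⁆)
    (hZi : Z ≤ U i) (hZ : ∀ z ∈ Z, z ∈ U (i + 1) → z = 1)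
    (hfix : ∀ z ∈ Z, (∀ t ∈ T, t * z = z * t) → z = 1) (hR : 2 * K ^ (18 * m + 21) ≤ R)
    (hD : ∀ x ∈ ⁅U 0, T⁆, ∃ a ∈ A ^ m, ∃ z ∈ Z, x = a * z) :
    ∀ x ∈ ⁅U 0, T⁆, x ∈ A ^ l := by
  -- The radius 3m is needed because a word of length 2m in `D` is corrected by one of length m,
  -- leaving a remainder in A^(3m) ∩ Z.
  obtain ⟨N, hN, hAN, hNA⟩ := h.exists_normal_le_pow (k := 3 * m) (l := l - m) (by omega)
    (by omega) hZi hZ hfix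
    (by rwa [show 6 * (3 * m) + 21 = 18 * m + 21 by ring])
  have hDn := h.commutator_normal
  set D := ⁅U 0, T⁆
  -- elements of `D` that are short words are equal modulo `N` to elements of `A ^ m`
  have key : ∀ x ∈ D, x ∈ A ^ (2 * m) → ∃ w ∈ A ^ m, w ∈ D ∧ ∃ z ∈ N, x = w * z := by
    intro x hx hxA
    obtain ⟨a, ha, z, hz, rfl⟩ := hD x hx
    refine ⟨a, ha, ?_, z, hAN z ?_ hz, rfl⟩
    · have := D.mul_mem hx (D.inv_mem (hZD hz))
      rwa [mul_inv_cancel_right] at this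
    · have := mul_mem_pow_add (inv_mem_pow h.inv_eq ha) hxA
      rwa [inv_mul_cancel_left, show m + 2 * m = 3 * m by ring] at this
  -- The set (A^m ∩ D)N is a group, since `key` reduces products back to length m modulo `N`. It is
  -- normal and contains the short words that normally generate `D`, so it contains `D`. The length
  -- is m + (l - m), with l - m ≥ 12 · 3m + 40.
  let B : Subgroup G :=
    { carrier := {x | ∃ w ∈ A ^ m, w ∈ D ∧ ∃ z ∈ N, x = w * z}
      one_mem' := ⟨1, h.one_mem_pow _, D.one_mem, 1, N.one_mem, by simp⟩
      mul_mem' := by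
        rintro _ _ ⟨w, hw, hwD, z, hz, rfl⟩ ⟨w', hw', hwD', z', hz', rfl⟩
        have h1 := mul_mem_pow_add hw hw'
        rw [← two_mul] at h1
        obtain ⟨v, hv, hvD, y, hy, e⟩ := key _ (D.mul_mem hwD hwD') h1
        refine ⟨v, hv, hvD, y * (w'⁻¹ * z * w'⁻¹⁻¹) * z',
          N.mul_mem (N.mul_mem hy (hN.conj_mem z hz w'⁻¹)) hz', ?_⟩
        calc w * z * (w' * z') = w * w' * (w'⁻¹ * z * w'⁻¹⁻¹) * z' := by group
          _ = _ := by rw [e]; group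
      inv_mem' := by
        rintro _ ⟨w, hw, hwD, z, hz, rfl⟩
        refine ⟨w⁻¹, inv_mem_pow h.inv_eq hw, D.inv_mem hwD, w * z⁻¹ * w⁻¹,
          hN.conj_mem _ (N.inv_mem hz) w, by group⟩ }
  have hBn : B.Normal := by
    refine Subgroup.normal_of_closure_eq_top (A := (A : Set G)) ?_ h.closure_eq ?_
    · rw [← coe_inv, h.inv_eq]
    · rintro a ha _ ⟨w, hw, hwD, z, hz, rfl⟩
      obtain ⟨v, hv, hvD, y, hy, e⟩ := key _ (hDn.conj_mem w hwD a)
        (h.pow_subset (by omega) (h.conj_mem_pow ha hw))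
      refine ⟨v, hv, hvD, y * (a * z * a⁻¹), N.mul_mem hy (hN.conj_mem z hz a), ?_⟩
      calc a * (w * z) * a⁻¹ = (a * w * a⁻¹) * (a * z * a⁻¹) := by group
        _ = _ := by rw [e]; group
  intro x hx
  obtain ⟨w, hw, -, z, hz, rfl⟩ := h.commutator_le_normalClosure hm hBn
    (fun x hxA hxD => ⟨x, hxA, hxD, 1, N.one_mem, by simp⟩) hx
  have := mul_mem_pow_add hw (hNA z hz)
  rwa [Nat.add_sub_cancel' (by omega)] at this

end GrowthData

/-! ### Commutator pairings and descent along central sections -/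

section CommutatorPairing

variable {G : Type*} [Group G] {X D Z : Subgroup G}

/-- The homomorphism `y ↦ (x ↦ ψ [x, y])` attached to a character `ψ` of a subgroup `Z` containing
`[X, D]` and centralized by `D`. -/
def commutatorPairing (hXD : ∀ x ∈ X, ∀ y ∈ D, ⁅x, y⁆ ∈ Z)
    (hZ : ∀ z ∈ Z, ∀ y ∈ D, z * y = y * z) (ψ : Z →* ℂˣ) : D →* (X → ℂˣ) where
  toFun y x := ψ ⟨⁅(x : G), (y : G)⁆, hXD x x.2 y y.2⟩
  map_one' := by
    ext x
    simp only [Pi.one_apply, Units.val_one]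
    have : (⟨⁅(x : G), ((1 : D) : G)⁆, hXD x x.2 _ (1 : D).2⟩ : Z) = 1 :=
      Subtype.ext (by simp)
    rw [this, map_one, Units.val_one]
  map_mul' y y' := by
    funext x
    rw [Pi.mul_apply, ← map_mul]
    congr 1
    apply Subtype.ext
    have e := hZ _ (hXD x x.2 y' y'.2) y y.2
    simp only [Subgroup.coe_mul]
    calc ⁅(x : G), (y : G) * y'⁆
        = ⁅(x : G), (y : G)⁆ * ((y : G) * ⁅(x : G), (y' : G)⁆) * (y : G)⁻¹ := by
          simp only [commutatorElement_def]; group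
      _ = _ := by rw [← e]; group

lemma commutatorPairing_apply (hXD : ∀ x ∈ X, ∀ y ∈ D, ⁅x, y⁆ ∈ Z)
    (hZ : ∀ z ∈ Z, ∀ y ∈ D, z * y = y * z) (ψ : Z →* ℂˣ) (y : D) (x : X) :
    commutatorPairing hXD hZ ψ y x = ψ ⟨⁅(x : G), (y : G)⁆, hXD x x.2 y y.2⟩ := rfl

/-- The sum of `ψ [x, y]` over all `x`, `y` counts the kernel of the pairing. -/
lemma sum_commutatorPairing [Finite G] [Fintype X] [Fintype D]
    (hXD : ∀ x ∈ X, ∀ y ∈ D, ⁅x, y⁆ ∈ Z) (hZ : ∀ z ∈ Z, ∀ y ∈ D, z * y = y * z)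
    (hZX : ∀ z ∈ Z, ∀ x ∈ X, z * x = x * z) (ψ : Z →* ℂˣ) :
    ∑ y : D, ∑ x : X, (commutatorPairing hXD hZ ψ y x : ℂ)
      = Fintype.card X * Nat.card (commutatorPairing hXD hZ ψ).ker := by
  classical
  -- For fixed y the map x ↦ ψ[x, y] is a character of `X`, whose sum is |X| or 0 according to
  -- whether it is trivial.
  have h1 : ∀ y : D, ∑ x : X, (commutatorPairing hXD hZ ψ y x : ℂ)
      = if y ∈ (commutatorPairing hXD hZ ψ).ker then (Fintype.card X : ℂ) else 0 := by
    intro y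
    let φ : X →* ℂ :=
      { toFun := fun x => (commutatorPairing hXD hZ ψ y x : ℂ)
        map_one' := by
          have : (⟨⁅((1 : X) : G), (y : G)⁆, hXD _ (1 : X).2 y y.2⟩ : Z) = 1 :=
            Subtype.ext (by simp)
          rw [commutatorPairing_apply, this, map_one, Units.val_one]
        map_mul' := by
          intro x x'
          rw [← Units.val_mul]
          congr 1
          simp only [commutatorPairing_apply]
          rw [← map_mul]
          congr 1
          apply Subtype.ext
          have e := hZX _ (hXD x' x'.2 y y.2) x x.2
          have e' := hZX _ (hXD x x.2 y y.2) x x.2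
          have e2 := hZ _ (hXD x' x'.2 y y.2) y y.2
          simp only [Subgroup.coe_mul]
          have e3 : ⁅(x' : G), (y : G)⁆ * ⁅(x : G), (y : G)⁆ =
              ⁅(x : G), (y : G)⁆ * ⁅(x' : G), (y : G)⁆ := by
            have c1 : Commute ⁅(x' : G), (y : G)⁆ (x : G) := e
            have c2 : Commute ⁅(x' : G), (y : G)⁆ (y : G) := e2
            rw [commutatorElement_def (x : G) (y : G)]
            exact (((c1.mul_right c2).mul_right c1.inv_right).mul_right c2.inv_right)
          calc ⁅(x : G) * x', (y : G)⁆
              = ((x : G) * ⁅(x' : G), (y : G)⁆) * (x : G)⁻¹ * ⁅(x : G), (y : G)⁆ := by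
                simp only [commutatorElement_def]; group
            _ = ⁅(x' : G), (y : G)⁆ * ⁅(x : G), (y : G)⁆ := by rw [← e]; group
            _ = _ := e3 }
    split_ifs with hy
    · have : ∀ x, (commutatorPairing hXD hZ ψ y x : ℂ) = 1 := by
        intro x
        rw [MonoidHom.mem_ker.1 hy]
        simp
      simp [this]
    · refine sum_hom_units_eq_zero φ fun hφ => hy ?_
      rw [MonoidHom.mem_ker]
      funext x
      apply Units.ext
      exact DFunLike.congr_fun hφ x
  rw [Finset.sum_congr rfl fun y _ => h1 y, Finset.sum_ite, Finset.sum_const, Finset.sum_const_zero,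
    add_zero, nsmul_eq_mul, mul_comm]
  congr 2
  rw [Nat.card_eq_fintype_card, Fintype.card_subtype]

end CommutatorPairing

namespace GrowthData

open Finset

variable {G : Type*} [Group G] [DecidableEq G] {L : ℕ} {U : ℕ → Subgroup G} {T : Subgroup G}
  {A : Finset G} {K R : ℝ}

/-- A nontrivial homomorphism from `[U 0, T]` to an abelian group whose kernel is `T`-invariant has
large image. -/
lemma lt_ncard_range (h : GrowthData L U T A K R) [Finite G] {D : Subgroup G} [hDn : D.Normal]
    (hD : D = ⁅U 0, T⁆) {C : Type*} [CommGroup C] (f : D →* C) (hf : f ≠ 1)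
    (hT : ∀ t ∈ T, ∀ y y' : D,
      f (MulAut.conjNormal t y) = f (MulAut.conjNormal t y') → f y = f y') :
    R < (Set.range f).ncard := by
  classical
  have hD0 : D ≤ U 0 := hD ▸ h.commutator_le_zero
  have hDc : D ≤ ⁅D, D ⊔ T⁆ := hD ▸ h.le_commutator
  -- Choose the last layer still seen by `f`: it is nontrivial on D ∩ U i and trivial on D ∩ U (i +
  -- 1).
  obtain ⟨i, ⟨x, hxi, hx⟩, hi⟩ : ∃ i, (∃ x : D, (x : G) ∈ U i ∧ f x ≠ 1) ∧
      ∀ x : D, (x : G) ∈ U (i + 1) → f x = 1 := by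
    have hex : ∃ i, ∀ x : D, (x : G) ∈ U i → f x = 1 := by
      refine ⟨L, fun x hx => ?_⟩
      rw [h.eq_bot, Subgroup.mem_bot] at hx
      rw [show x = 1 from Subtype.ext hx, map_one]
    have hpos : Nat.find hex ≠ 0 := by
      intro h0
      refine hf (MonoidHom.ext fun x => ?_)
      have := Nat.find_spec hex
      rw [h0] at this
      exact this x (hD0 x.2)
    obtain ⟨i, hi⟩ := Nat.exists_eq_succ_of_ne_zero hpos
    refine ⟨i, ?_, ?_⟩
    · have := Nat.find_min hex (m := i) (by omega)
      push Not at this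
      exact this
    · have := Nat.find_spec hex
      rwa [hi] at this
  have hconj : ∀ g : G, f (MulAut.conjNormal g x) = f x ↔
      f (⟨⁅g, (x : G)⁆, by
        rw [commutatorElement_def]
        exact mul_mem (hDn.conj_mem x x.2 g) (inv_mem x.2)⟩) = 1 := by
    intro g
    rw [← mul_inv_eq_one, ← map_inv, ← map_mul]
    exact Iff.rfl
  rcases h.roots i with hroot | hroot
  · exfalso
    apply hx
    -- If the action on this layer were trivial, f(x) would be fixed by `T`; the norm argument and
    -- coprimality then give f(x) = 1.
    have h1 := pow_card_eq_one_of_fixed f (D := D) (T := T) ?_ (hDc x.2)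
      fun t ht => (hconj t).2 (hi _ (hroot t x hxi))
    · rw [← map_pow] at h1
      refine Subgroup.mem_of_pow_mem_of_coprime (N := f.ker) ?_ h1
      rw [← Subgroup.orderOf_coe]
      exact h.coprime_orderOf (hD0 x.2)
    · intro d hd m
      have : MulAut.conjNormal d m = (⟨d, hd⟩ : D) * m * (⟨d, hd⟩ : D)⁻¹ := by
        apply Subtype.ext
        simp
      rw [this, map_mul, map_mul, map_inv, mul_comm, inv_mul_cancel_left]
  · refine hroot.trans_le (Nat.cast_le.2 ?_)
    choose u hu t ht hut using h.exists_mul_eq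
    -- The values of `f` on the conjugates of x by the `T`-parts of elements of `A` separate their
    -- actions on the layer. If two values agree, τ fixes f(x), so [τ, x] lies in the kernel of `f`.
    -- Were τ fixed-point-free, x would lie in the product of (ker f) ∩ U i and U (i + 1), forcing
    -- f(x) = 1.
    refine (Set.ncard_image_le_of_forall (g := fun a => f (MulAut.conjNormal (t a) x))
      (finite_toSet A) ?_).trans (Set.ncard_le_ncard ?_ (Set.finite_range f))
    · intro a _ b _ hab
      rw [QuotientGroup.eq]
      set τ := (t a)⁻¹ * t b with hτ
      have hτT : τ ∈ T := mul_mem (inv_mem (ht a)) (ht b)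
      have hτx : f (MulAut.conjNormal τ x) = f x := by
        refine hT (t a) (ht a) _ _ ?_
        rw [← MulAut.mul_apply, ← map_mul, hτ, mul_inv_cancel_left]
        exact hab.symm
      have hτC : τ ∈ layerKernel (U i) (U (i + 1)) (h.normal i) := by
        rcases h.semiregular i τ with hg | hg
        · exact hg
        · exfalso
          have hker := (hconj τ).1 hτx
          have hmem := h.mem_sup hg (S := f.ker.map D.subtype ⊓ U i) inf_le_right ?_ hxi ?_
          · have := h.normal (i + 1)
            rw [Subgroup.mem_sup_of_normal_right] at hmem
            obtain ⟨_, ⟨⟨s, hs, rfl⟩, -⟩, v, hv, e⟩ := hmem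
            have hvD : v = ((s⁻¹ * x : D) : G) := by
              rw [Subgroup.coe_mul, Subgroup.coe_inv, ← e]
              simp
            rw [hvD] at hv
            have h1 := hi _ hv
            rw [map_mul, map_inv, MonoidHom.mem_ker.1 hs, inv_one, one_mul] at h1
            exact hx h1
          · rintro _ ⟨⟨s, hs, rfl⟩, hsi⟩
            refine ⟨⟨MulAut.conjNormal τ s, ?_, by simp⟩, (h.normal i).conj_mem _ hsi τ⟩
            have : f s = f 1 := by rw [MonoidHom.mem_ker.1 hs, map_one]
            rw [SetLike.mem_coe, MonoidHom.mem_ker]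
            have h2 := hT τ⁻¹ (inv_mem hτT) (MulAut.conjNormal τ s) 1 (by
              rw [← MulAut.mul_apply, ← map_mul, inv_mul_cancel, map_one, map_one]
              exact this)
            rw [h2, map_one]
          · refine Subgroup.mem_sup_left ⟨⟨_, hker, rfl⟩, ?_⟩
            rw [commutatorElement_def]
            exact (U i).mul_mem ((h.normal i).conj_mem _ hxi τ) ((U i).inv_mem hxi)
      have e : a⁻¹ * b = ((t a)⁻¹ * ((u a)⁻¹ * u b) * (t a)⁻¹⁻¹) * τ := by
        conv_lhs => rw [hut a, hut b]
        rw [hτ]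
        group
      rw [e]
      refine mul_mem (h.zero_le_layerKernel i ?_) hτC
      exact (h.normal 0).conj_mem _ (mul_mem (inv_mem (hu a)) (hu b)) _
    · rintro _ ⟨a, _, rfl⟩
      exact ⟨_, rfl⟩

/-- One step of the descent along a section with trivial action. -/
lemma subset_pow_of_central (h : GrowthData L U T A K R) [Finite G] {X Z : Subgroup G}
    [Z.Normal] {m l : ℕ} (hl : 9 * m + 4 ≤ l) (hX : X.Normal) (hXD : X ≤ ⁅U 0, T⁆)
    (hZX : Z = ⁅X, ⁅U 0, T⁆⁆) (hZ : ∀ z ∈ Z, ∀ o ∈ ⁅U 0, T⁆ ⊔ T, z * o = o * z)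
    (hR : 2 * K ^ (4 * m + 3) ≤ R)
    (hD : ∀ x ∈ ⁅U 0, T⁆, ∃ a ∈ A ^ m, ∃ z ∈ Z, x = a * z) :
    ∀ x ∈ ⁅U 0, T⁆, x ∈ A ^ l := by
  classical
  have hDn := h.commutator_normal
  set D := ⁅U 0, T⁆ with hDdef
  have hZD : Z ≤ D := by rw [hZX]; exact Subgroup.commutator_le_right _ _
  have hZcD : ∀ z ∈ Z, ∀ y ∈ D, z * y = y * z := fun z hz y hy =>
    hZ z hz y (Subgroup.mem_sup_left hy)
  have hZcX : ∀ z ∈ Z, ∀ x ∈ X, z * x = x * z := fun z hz x hx => hZcD z hz x (hXD hx)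
  have hXDZ : ∀ x ∈ X, ∀ y ∈ D, ⁅x, y⁆ ∈ Z := by
    intro x hx y hy
    rw [hZX]
    exact Subgroup.commutator_mem_commutator hx hy
  let _ : CommGroup Z :=
    { (inferInstance : Group Z) with
      mul_comm := fun x y => Subtype.ext (hZcD x x.2 y (hZD y.2)) }
  have := Fintype.ofFinite (Additive Z)
  have := Fintype.ofFinite X
  have := Fintype.ofFinite D
  obtain ⟨W, hW⟩ : ∃ W : ℕ → Finset (Additive Z), ∀ j v, v ∈ W j ↔ (v.toMul : G) ∈ A ^ j :=
    ⟨fun j => univ.filter fun v => (v.toMul : G) ∈ A ^ j, fun j v => by simp⟩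
  have hWcard : ∀ j, #(W j) = #{x ∈ A ^ j | x ∈ Z} := by
    intro j
    refine card_bij (fun v _ => (v.toMul : G)) ?_ ?_ ?_
    · intro v hv
      exact mem_filter.2 ⟨(hW j v).1 hv, v.toMul.2⟩
    · intro v _ w _ e
      exact Subtype.ext e
    · intro x hx
      rw [mem_filter] at hx
      exact ⟨Additive.ofMul ⟨x, hx.2⟩, (hW j _).2 hx.1, rfl⟩
  have hWadd : ∀ {j l v w}, v ∈ W j → w ∈ W l → v + w ∈ W (j + l) := by
    intro j l v w hv hw
    rw [hW] at *
    exact mul_mem_pow_add hv hw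
  -- commutators are short words
  have hshort : ∀ x ∈ X, ∀ y ∈ D, ⁅x, y⁆ ∈ A ^ (4 * m) := by
    intro x hx y hy
    obtain ⟨a, ha, z, hz, rfl⟩ := hD x (hXD hx)
    obtain ⟨b, hb, w, hw, rfl⟩ := hD y hy
    have haD : a ∈ D := by
      have := D.mul_mem (hXD hx) (D.inv_mem (hZD hz))
      rwa [mul_inv_cancel_right] at this
    have hbD : b ∈ D := by
      have := D.mul_mem hy (D.inv_mem (hZD hw))
      rwa [mul_inv_cancel_right] at this
    -- The factors z and w drop out because `Z` is centralized by `D`.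
    have e : ⁅a * z, b * w⁆ = ⁅a, b⁆ := by
      have c1 : Commute z b := hZcD z hz b hbD
      have c2 : Commute z w := hZcD z hz w (hZD hw)
      have c3 : Commute w a := hZcD w hw a haD
      calc ⁅a * z, b * w⁆ = a * (z * (b * w) * z⁻¹) * a⁻¹ * w⁻¹ * b⁻¹ := by
            simp only [commutatorElement_def]; group
        _ = a * b * (w * a⁻¹) * w⁻¹ * b⁻¹ := by
            rw [(c1.mul_right c2).eq]; group
        _ = ⁅a, b⁆ := by
            rw [c3.inv_right.eq, commutatorElement_def]; group
    rw [e, commutatorElement_def]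
    have := mul_mem_pow_add (mul_mem_pow_add (mul_mem_pow_add ha hb)
      (inv_mem_pow h.inv_eq ha)) (inv_mem_pow h.inv_eq hb)
    rwa [show m + m + m + m = 4 * m by ring] at this
  have hKone : 1 ≤ K ^ (4 * m + 3) := one_le_pow₀ h.one_le
  have hRpos : 0 < R := by linarith
  have hpos : 0 < #(W 2) := card_pos.2 ⟨0, (hW 2 0).2 (h.one_mem_pow _)⟩
  have hpos' : (0 : ℝ) < #(W 2) := by exact_mod_cast hpos
  have hcover : ∀ v : Additive Z, ∃ q₁ ∈ W (4 * m + 2), ∃ q₂ ∈ W (4 * m + 2), v = q₁ + q₂ := by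
    refine exists_add_eq_of_fourier_small
      (b := fun i : D × X => Additive.ofMul (⟨⁅(i.2 : G), (i.1 : G)⁆, hXDZ _ i.2.2 _ i.1.2⟩ : Z))
      (W 2) (W (4 * m + 2)) (card_pos.1 hpos) R hRpos ?_ ?_ ?_
    · intro ψ hψ
      let ψ' : Z →* ℂˣ := MonoidHom.toHomUnits
        { toFun := fun z => ψ (Additive.ofMul z)
          map_one' := ψ.map_zero_eq_one
          map_mul' := fun a b => ψ.map_add_eq_mul _ _ }
      have hψ' : ∀ z : Z, (ψ' z : ℂ) = ψ (Additive.ofMul z) := fun z => rfl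
      set f := commutatorPairing hXDZ hZcD ψ' with hfdef
      have hsum : ∑ i : D × X,
          ψ (Additive.ofMul (⟨⁅(i.2 : G), (i.1 : G)⁆, hXDZ _ i.2.2 _ i.1.2⟩ : Z))
          = Fintype.card X * Nat.card f.ker := by
        rw [← sum_commutatorPairing hXDZ hZcD hZcX ψ', Fintype.sum_prod_type]
        rfl
      rw [hsum]
      -- The commutators [x, y] generate `Z`, so a nontrivial character cannot vanish on all of
      -- them.
      have hf1 : f ≠ 1 := by
        intro hf1
        apply hψ
        have hle : Z ≤ ψ'.ker.map Z.subtype := by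
          conv_lhs => rw [hZX]
          refine Subgroup.commutator_le.2 fun x hx y hy => ?_
          refine ⟨⟨⁅x, y⁆, hXDZ x hx y hy⟩, ?_, rfl⟩
          rw [SetLike.mem_coe, MonoidHom.mem_ker]
          have := congrFun (DFunLike.congr_fun hf1 ⟨y, hy⟩) ⟨x, hx⟩
          exact this
        ext v
        obtain ⟨z, hz, hzv⟩ := hle v.toMul.2
        have hzv' : z = v.toMul := Subtype.ext hzv
        have h1 : (ψ' z : ℂ) = 1 := by rw [MonoidHom.mem_ker.1 hz, Units.val_one]
        rw [hψ', hzv'] at h1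
        simpa using h1
      have hrange := h.lt_ncard_range hDdef f hf1 ?_
      · have hcard : Nat.card f.ker * (Set.range f).ncard = Nat.card D := by
          rw [← Subgroup.card_mul_index f.ker, Subgroup.index_ker, ← Nat.card_coe_set_eq]
          rfl
        have hcard' : (Nat.card f.ker : ℝ) * (Set.range f).ncard = Nat.card D := by
          exact_mod_cast hcard
        rw [Fintype.card_prod, Nat.cast_mul, ← Nat.card_eq_fintype_card (α := D), ← hcard']
        rw [norm_mul, Complex.norm_natCast, Complex.norm_natCast]
        calc R * ((Fintype.card X : ℝ) * Nat.card f.ker)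
            ≤ (Set.range f).ncard * ((Fintype.card X : ℝ) * Nat.card f.ker) := by gcongr
          _ = _ := by ring
      · intro t ht y y' hyy'
        funext x
        have hx' : t * (x : G) * t⁻¹ ∈ X := hX.conj_mem x x.2 t
        -- Conjugating both x and y by t conjugates [x, y], which `T` centralizes.
        have key : ∀ y : D, f (MulAut.conjNormal t y) ⟨t * (x : G) * t⁻¹, hx'⟩ = f y x := by
          intro y
          simp only [hfdef, commutatorPairing_apply]
          congr 1
          apply Subtype.ext
          simp only [MulAut.conjNormal_apply]
          rw [← conjugate_commutatorElement,
            ← hZ _ (hXDZ x x.2 y y.2) t (Subgroup.mem_sup_right ht), mul_inv_cancel_right]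
        rw [← key y, ← key y', hyy']
    · rintro v hv ⟨y, x⟩
      have : Additive.ofMul (⟨⁅(x : G), (y : G)⁆, hXDZ _ x.2 _ y.2⟩ : Z) ∈ W (4 * m) :=
        (hW _ _).2 (hshort x x.2 y y.2)
      have := hWadd hv this
      rwa [add_comm 2] at this
    · have h1 := h.card_pow_inter_le Z (4 * m + 2)
      rw [← hWcard, ← hWcard] at h1
      -- The hypothesis on `R` gives R ≥ 2.
      have h2 : R ≤ R ^ 2 := by nlinarith
      calc 2 * (#(W (4 * m + 2)) : ℝ) ≤ 2 * K ^ (4 * m + 3) * #(W 2) := by linarith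
        _ ≤ R * #(W 2) := by gcongr
        _ < R ^ 2 * #(W 2) := by
          gcongr
          nlinarith
  intro x hx
  obtain ⟨a, ha, z, hz, rfl⟩ := hD x hx
  obtain ⟨q₁, hq₁, q₂, hq₂, e⟩ := hcover (Additive.ofMul ⟨z, hz⟩)
  have h1 := (hW _ _).1 (hWadd hq₁ hq₂)
  rw [← e] at h1
  exact h.pow_subset (by omega) (mul_mem_pow_add ha h1)

end GrowthData

/-! ### Descent through the lower central series of `⁅U 0, T⁆` -/

/-- One step of the recursion for the word length needed in the descent. -/
def descentStep (m : ℕ) : ℕ := 37 * m + 40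

lemma le_iterate_descentStep (j m : ℕ) : m ≤ descentStep^[j] m := by
  induction j with
  | zero => rfl
  | succ j ih =>
    rw [Function.iterate_succ_apply']
    unfold descentStep at *
    omega

lemma iterate_descentStep_mono {j k : ℕ} (hjk : j ≤ k) (m : ℕ) :
    descentStep^[j] m ≤ descentStep^[k] m := by
  obtain ⟨d, rfl⟩ := Nat.exists_eq_add_of_le' hjk
  rw [Function.iterate_add_apply]
  exact le_iterate_descentStep _ _

namespace GrowthData

open Finset

variable {G : Type*} [Group G] [DecidableEq G] {L : ℕ} {U : ℕ → Subgroup G} {T : Subgroup G}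
  {A : Finset G} {K R : ℝ}

lemma lowerCentralSeries_commutator_le (h : GrowthData L U T A K R) (k : ℕ) :
    (⁅U 0, T⁆).lowerCentralSeries k ≤ U k := by
  induction k with
  | zero => exact h.commutator_le_zero
  | succ k ih =>
    exact (Subgroup.commutator_mono ih h.commutator_le_zero).trans (h.commutator_le k)

/-- A covering of the image of `[U 0, T]` in `G / Y` by short words lifts to `G`. -/
lemma exists_mul_of_quotient [Finite G] {Y : Subgroup G} [Y.Normal] [DecidableEq (G ⧸ Y)] {l : ℕ}
    (hl : ∀ x ∈ ⁅(U 0).map (QuotientGroup.mk' Y), T.map (QuotientGroup.mk' Y)⁆,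
      x ∈ (A.image (QuotientGroup.mk' Y)) ^ l) :
    ∀ x ∈ ⁅U 0, T⁆, ∃ a ∈ A ^ l, ∃ z ∈ Y, x = a * z := by
  intro x hx
  have h1 := hl (QuotientGroup.mk' Y x) (by
    rw [← Subgroup.map_commutator]
    exact Subgroup.mem_map_of_mem _ hx)
  rw [← Finset.image_pow] at h1
  obtain ⟨a, ha, e⟩ := mem_image.1 h1
  exact ⟨a, ha, a⁻¹ * x, QuotientGroup.eq.1 e, by group⟩

lemma exists_mul_quotient {X Y : Subgroup G} [Y.Normal] [DecidableEq (G ⧸ Y)] {m : ℕ}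
    (hm : ∀ x ∈ ⁅U 0, T⁆, ∃ a ∈ A ^ m, ∃ z ∈ X, x = a * z) :
    ∀ x ∈ ⁅(U 0).map (QuotientGroup.mk' Y), T.map (QuotientGroup.mk' Y)⁆,
      ∃ a ∈ (A.image (QuotientGroup.mk' Y)) ^ m, ∃ z ∈ X.map (QuotientGroup.mk' Y), x = a * z := by
  intro x hx
  rw [← Subgroup.map_commutator] at hx
  obtain ⟨x, hx, rfl⟩ := hx
  obtain ⟨a, ha, z, hz, rfl⟩ := hm x hx
  refine ⟨_, ?_, _, Subgroup.mem_map_of_mem _ hz, map_mul _ a z⟩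
  rw [← Finset.image_pow]
  exact mem_image_of_mem _ ha

/-- Descent from a term of the lower central series of `[U 0, T]` to the part on which `T` acts
nontrivially. -/
lemma descend_central (h : GrowthData L U T A K R) [Finite G] {k m l : ℕ}
    (hl : 9 * m + 4 ≤ l) (hR : 2 * (K ^ 3) ^ (4 * m + 3) ≤ R)
    (hm : ∀ x ∈ ⁅U 0, T⁆, ∃ a ∈ A ^ m, ∃ z ∈ (⁅U 0, T⁆).lowerCentralSeries (k + 1), x = a * z) :
    ∀ x ∈ ⁅U 0, T⁆, ∃ a ∈ A ^ l,
      ∃ z ∈ ⁅(⁅U 0, T⁆).lowerCentralSeries (k + 1), ⁅U 0, T⁆ ⊔ T⁆, x = a * z := by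
  classical
  have hD := h.commutator_normal
  have hO := h.sup_normal
  have hk := Subgroup.lowerCentralSeries_normal (S := ⁅U 0, T⁆) k
  have hk1 := Subgroup.lowerCentralSeries_normal (S := ⁅U 0, T⁆) (k + 1)
  set D := ⁅U 0, T⁆ with hDdef
  -- Dividing by `Y` is exactly what makes the image of this term of the series commute with `D ⊔
  -- T`; passing to the quotient costs the cube of `K`.
  set Y := ⁅D.lowerCentralSeries (k + 1), D ⊔ T⁆ with hY
  set π := QuotientGroup.mk' Y with hπ
  have hsurj : Function.Surjective π := QuotientGroup.mk'_surjective Y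
  have hZn : ((D.lowerCentralSeries (k + 1)).map π).Normal := hk1.map π hsurj
  have hmapD : ⁅(U 0).map π, T.map π⁆ = D.map π := (Subgroup.map_commutator _ _ π).symm
  refine exists_mul_of_quotient (Y := Y) ?_
  refine (h.quotient Y).subset_pow_of_central (X := (D.lowerCentralSeries k).map π)
    (Z := (D.lowerCentralSeries (k + 1)).map π) hl (hk.map π hsurj) ?_ ?_ ?_ hR
    (exists_mul_quotient hm)
  · change _ ≤ ⁅(U 0).map π, T.map π⁆
    rw [hmapD]
    exact Subgroup.map_mono (D.lowerCentralSeries_antitone (Nat.zero_le k))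
  · change _ = ⁅_, ⁅(U 0).map π, T.map π⁆⁆
    rw [hmapD, ← Subgroup.map_commutator, ← Subgroup.lowerCentralSeries_succ]
  · change ∀ z ∈ _, ∀ o ∈ ⁅(U 0).map π, T.map π⁆ ⊔ T.map π, _
    rw [hmapD, ← Subgroup.map_sup]
    rintro _ ⟨z, hz, rfl⟩ _ ⟨o, ho, rfl⟩
    rw [← commutatorElement_eq_one_iff_mul_comm, ← map_commutatorElement]
    exact (QuotientGroup.eq_one_iff _).2 (Subgroup.commutator_mem_commutator hz ho)

/-- Descent along one layer of the part of a factor of the lower central series of `[U 0, T]` on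
which `T` acts nontrivially. -/
lemma descend_semiregular (h : GrowthData L U T A K R) [Finite G] {k i m l : ℕ}
    (hm0 : commutatorLength (L + 1) ≤ m) (hm2 : 2 ≤ m)
    (hl : 37 * m + 40 ≤ l) (hR : 2 * (K ^ 3) ^ (18 * m + 21) ≤ R)
    (hm : ∀ x ∈ ⁅U 0, T⁆, ∃ a ∈ A ^ m,
      ∃ z ∈ (⁅(⁅U 0, T⁆).lowerCentralSeries k, ⁅U 0, T⁆ ⊔ T⁆ ⊓ U i) ⊔
        (⁅U 0, T⁆).lowerCentralSeries (k + 1), x = a * z) :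
    ∀ x ∈ ⁅U 0, T⁆, ∃ a ∈ A ^ l,
      ∃ z ∈ (⁅(⁅U 0, T⁆).lowerCentralSeries k, ⁅U 0, T⁆ ⊔ T⁆ ⊓ U (i + 1)) ⊔
        (⁅U 0, T⁆).lowerCentralSeries (k + 1), x = a * z := by
  classical
  have hD := h.commutator_normal
  have hO := h.sup_normal
  have hk := Subgroup.lowerCentralSeries_normal (S := ⁅U 0, T⁆) k
  have hk1 := Subgroup.lowerCentralSeries_normal (S := ⁅U 0, T⁆) (k + 1)
  have hi := h.normal i
  have hi1 := h.normal (i + 1)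
  set D := ⁅U 0, T⁆ with hDdef
  set M := D.lowerCentralSeries k with hM
  set M' := D.lowerCentralSeries (k + 1) with hM'
  have hM'eq : M' = ⁅M, D⁆ := Subgroup.lowerCentralSeries_succ _ _
  set P := ⁅M, D ⊔ T⁆ with hP
  have hMD : M ≤ D := D.lowerCentralSeries_antitone (Nat.zero_le k)
  have hPM : P ≤ M := Subgroup.commutator_le_left _ _
  have hM'P : M' ≤ P := hM'eq ▸ Subgroup.commutator_mono le_rfl le_sup_left
  -- In `G / Y` the image of `M` is abelian, since [M, D] = M' ≤ Y, and the image of P ∩ U i meets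
  -- that of U (i + 1) trivially, since Y ≤ P.
  set Y := (P ⊓ U (i + 1)) ⊔ M' with hY
  have hM'Y : M' ≤ Y := le_sup_right
  have hYP : Y ≤ P := sup_le inf_le_left hM'P
  set π := QuotientGroup.mk' Y with hπ
  have hsurj : Function.Surjective π := QuotientGroup.mk'_surjective Y
  have hone : ∀ y ∈ Y, π y = 1 := fun y hy => (QuotientGroup.eq_one_iff y).2 hy
  have hZn : ((P ⊓ U i ⊔ M').map π).Normal :=
    (inferInstance : (P ⊓ U i ⊔ M').Normal).map π hsurj
  have hMn : (M.map π).Normal := hk.map π hsurj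
  have hmapD : ⁅(U 0).map π, T.map π⁆ = D.map π := (Subgroup.map_commutator _ _ π).symm
  have hDn : (D.map π).Normal := hD.map π hsurj
  have hrep : ∀ z ∈ (P ⊓ U i ⊔ M').map π, ∃ r ∈ P ⊓ U i, z = π r := by
    rintro _ ⟨x, hx, rfl⟩
    rw [SetLike.mem_coe, Subgroup.mem_sup_of_normal_right] at hx
    obtain ⟨r, hr, y, hy, rfl⟩ := hx
    exact ⟨r, hr, by rw [map_mul, hone y (hM'Y hy), mul_one]⟩
  have hq := h.quotient Y
  refine exists_mul_of_quotient (Y := Y) ?_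
  refine hq.subset_pow_of_semiregular (Z := (P ⊓ U i ⊔ M').map π) (i := i) hm0 hm2 hl
    ?_ ?_ ?_ ?_ hR (exists_mul_quotient hm)
  · change _ ≤ ⁅(U 0).map π, T.map π⁆
    rw [hmapD]
    exact Subgroup.map_mono (sup_le (inf_le_left.trans (hPM.trans hMD))
      (hM'P.trans (hPM.trans hMD)))
  · intro z hz
    obtain ⟨r, hr, rfl⟩ := hrep z hz
    exact Subgroup.mem_map_of_mem π hr.2
  · intro z hz hz'
    obtain ⟨r, hr, rfl⟩ := hrep z hz
    obtain ⟨u, hu, e⟩ := hz'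
    have hru : r⁻¹ * u ∈ Y := QuotientGroup.eq.1 e.symm
    have huP : u ∈ P := by
      have := P.mul_mem hr.1 (hYP hru)
      rwa [mul_inv_cancel_left] at this
    change π u = π r at e
    rw [← e]
    exact hone u (Subgroup.mem_sup_left ⟨huP, hu⟩)
  · intro z hz hfix
    obtain ⟨r, hr, rfl⟩ := hrep z hz
    have hcommM : ∀ a ∈ M, ∀ d ∈ D, π a * π d = π d * π a := by
      intro a ha d hd
      rw [← commutatorElement_eq_one_iff_mul_comm, ← map_commutatorElement]
      refine hone _ (hM'Y ?_)
      rw [hM'eq]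
      exact Subgroup.commutator_mem_commutator ha hd
    let _ : CommGroup (M.map π) :=
      { (inferInstance : Group (M.map π)) with
        mul_comm := by
          rintro ⟨_, ⟨a, ha, rfl⟩⟩ ⟨_, ⟨b, hb, rfl⟩⟩
          exact Subtype.ext (hcommM a ha b (hMD hb)) }
    have hrM : π r ∈ M.map π := Subgroup.mem_map_of_mem π (hPM hr.1)
    -- The norm argument with `f` the identity of `M / Y`: a `T`-fixed element of the image of [M,
    -- DT] is killed by |T|, hence trivial by coprimality.
    have h1 := pow_card_eq_one_of_fixed (M := M.map π) (D := D.map π) (T := T.map π)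
      (MonoidHom.id (M.map π)) ?_ (x := ⟨π r, hrM⟩) ?_ ?_
    · have h2 : π r ^ Nat.card (T.map π) = 1 := congrArg Subtype.val h1
      have h3 : π r ∈ (⊥ : Subgroup (G ⧸ Y)) := by
        refine Subgroup.mem_of_pow_mem_of_coprime (hq.coprime_orderOf (x := π r) ?_)
          (Subgroup.mem_bot.2 h2)
        exact Subgroup.mem_map_of_mem π (h.commutator_le_zero (hMD (hPM hr.1)))
      exact Subgroup.mem_bot.1 h3
    · rintro _ ⟨d, hd, rfl⟩ ⟨_, ⟨a, ha, rfl⟩⟩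
      apply Subtype.ext
      simp only [MonoidHom.id_apply, MulAut.conjNormal_apply]
      rw [← hcommM a ha d hd, mul_inv_cancel_right]
    · change π r ∈ _
      rw [← Subgroup.map_sup, ← Subgroup.map_commutator]
      exact Subgroup.mem_map_of_mem π hr.1
    · intro t ht
      apply Subtype.ext
      simp only [MonoidHom.id_apply, MulAut.conjNormal_apply]
      rw [hfix t ht, mul_inv_cancel_right]

/-- The descent through all layers: `[U 0, T]` is covered by words of bounded length. -/
theorem commutator_subset_pow (h : GrowthData L U T A K R) [Finite G] {m₀ m : ℕ}
    (hm₀ : m₀ = commutatorLength (L + 1) + 2) (hm : m = descentStep^[(L + 1) * (L + 1)] m₀)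
    (hR : 2 * K ^ (54 * m + 63) ≤ R) :
    ∀ x ∈ ⁅U 0, T⁆, x ∈ A ^ m := by
  have hpow : ∀ e : ℕ, e ≤ 54 * m + 63 → 2 * K ^ e ≤ R := fun e he =>
    (mul_le_mul_of_nonneg_left (pow_le_pow_right₀ h.one_le he) zero_le_two).trans hR
  have hD := h.commutator_normal
  -- descent through the layers of one factor
  have hlayers : ∀ k a : ℕ, m₀ ≤ a → ∀ i, descentStep^[i] a ≤ m →
      (∀ x ∈ ⁅U 0, T⁆, ∃ b ∈ A ^ a,
        ∃ z ∈ ⁅(⁅U 0, T⁆).lowerCentralSeries k, ⁅U 0, T⁆ ⊔ T⁆, x = b * z) →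
      ∀ x ∈ ⁅U 0, T⁆, ∃ b ∈ A ^ (descentStep^[i] a),
        ∃ z ∈ (⁅(⁅U 0, T⁆).lowerCentralSeries k, ⁅U 0, T⁆ ⊔ T⁆ ⊓ U i) ⊔
          (⁅U 0, T⁆).lowerCentralSeries (k + 1), x = b * z := by
    intro k a ha i
    induction i with
    | zero =>
      intro _ hQ x hx
      obtain ⟨b, hb, z, hz, e⟩ := hQ x hx
      refine ⟨b, hb, z, Subgroup.mem_sup_left ⟨hz, ?_⟩, e⟩
      have hk := Subgroup.lowerCentralSeries_normal (S := ⁅U 0, T⁆) k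
      exact h.commutator_le_zero ((⁅U 0, T⁆).lowerCentralSeries_antitone (Nat.zero_le k)
        (Subgroup.commutator_le_left _ _ hz))
    | succ i ih =>
      intro hi hQ
      have hle : descentStep^[i] a ≤ m := (iterate_descentStep_mono (Nat.le_succ i) a).trans hi
      have hai := le_iterate_descentStep i a
      refine h.descend_semiregular (m := descentStep^[i] a) (by omega) (by omega) ?_ ?_
        (ih hle hQ)
      · rw [Function.iterate_succ_apply', descentStep]
      · rw [← pow_mul]
        exact hpow _ (by omega)
  -- Each k costs `L` layer steps and one central step. The induction starts from D = [D, DT] and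
  -- ends at k = L, where the remaining subgroup lies in U L = 1.
  have hmain : ∀ k : ℕ, k ≤ L → ∀ x ∈ ⁅U 0, T⁆,
      ∃ b ∈ A ^ (descentStep^[(L + 1) * k] m₀),
        ∃ z ∈ ⁅(⁅U 0, T⁆).lowerCentralSeries k, ⁅U 0, T⁆ ⊔ T⁆, x = b * z := by
    intro k
    induction k with
    | zero =>
      intro _ x hx
      exact ⟨1, h.one_mem_pow _, x, h.le_commutator hx, by simp⟩
    | succ k ih =>
      intro hk
      have hbound : descentStep^[(L + 1) * (k + 1)] m₀ ≤ m := by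
        rw [hm]
        exact iterate_descentStep_mono (Nat.mul_le_mul_left _ (by omega)) _
      have hsplit : descentStep^[(L + 1) * (k + 1)] m₀
          = descentStep (descentStep^[L] (descentStep^[(L + 1) * k] m₀)) := by
        rw [← Function.iterate_succ_apply' descentStep, ← Function.iterate_add_apply]
        congr 1
        rw [Nat.succ_eq_add_one]
        ring
      set a := descentStep^[(L + 1) * k] m₀ with ha
      have hLm : descentStep^[L] a ≤ m := by
        have h1 := le_iterate_descentStep 1 (descentStep^[L] a)
        rw [hsplit] at hbound
        exact le_trans h1 hbound
      have h1 := hlayers k a (le_iterate_descentStep _ _) L hLm (ih (by omega))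
      rw [h.eq_bot, inf_bot_eq, bot_sup_eq] at h1
      rw [hsplit]
      refine h.descend_central (m := descentStep^[L] a) ?_ ?_ h1
      · unfold descentStep
        omega
      · rw [← pow_mul]
        exact hpow _ (by omega)
  intro x hx
  obtain ⟨b, hb, z, hz, rfl⟩ := hmain L le_rfl x hx
  have hz1 : z = 1 := by
    have hk := Subgroup.lowerCentralSeries_normal (S := ⁅U 0, T⁆) L
    have h1 := h.lowerCentralSeries_commutator_le L (Subgroup.commutator_le_left _ _ hz)
    rwa [h.eq_bot, Subgroup.mem_bot] at h1
  rw [hz1, mul_one]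
  refine h.pow_subset ?_ hb
  rw [hm]
  exact iterate_descentStep_mono (Nat.mul_le_mul_left _ (by omega)) _

end GrowthData

/-! ### Filtration of triangular matrices by entries -/

section Triangular

variable {n : ℕ} {E : Type*} [Field E]

/-- The position of the matrix entry `(r, s)` in the enumeration of the entries above the diagonal
by diagonals; entries on or below the diagonal have position less than `n`. -/
def entryIndex (r s : Fin n) : ℕ := ((s : ℕ) - r) * n + r

/-- Moving down a column loses at least n from the superdiagonal term and gains less than n from the
row. Once the diagonal is reached, truncated subtraction leaves only the row number, which is below
n; hence the threshold i + n. -/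
lemma entryIndex_lt_of_lt_left {r t s : Fin n} {i : ℕ} (hrt : r < t)
    (h : entryIndex r s ≤ i + n) : entryIndex t s < i + n := by
  unfold entryIndex at *
  have ht := t.2
  have hrt' : (r : ℕ) < t := hrt
  rcases le_or_gt (t : ℕ) s with hts | hts
  · obtain ⟨d, hd⟩ : ∃ d, (s : ℕ) - r = (s - t) + 1 + d := ⟨t - r - 1, by omega⟩
    rw [hd] at h
    have : ((s : ℕ) - t + 1 + d) * n = (s - t) * n + n + d * n := by ring
    have hdn := Nat.zero_le (d * n)
    omega
  · rw [Nat.sub_eq_zero_of_le hts.le]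
    omega

lemma entryIndex_le_of_le_right {r t s : Fin n} (hts : t ≤ s) :
    entryIndex r t ≤ entryIndex r s := by
  unfold entryIndex
  have hts' : (t : ℕ) ≤ s := hts
  gcongr

lemma entryIndex_lt_of_lt_right {r t s : Fin n} {i : ℕ} (hts : t < s)
    (h : entryIndex r s = i + n) : entryIndex r t < i + n := by
  unfold entryIndex at *
  have hts' : (t : ℕ) < s := hts
  have hr := r.2
  have hn : 0 < n := by omega
  rcases le_or_gt (s : ℕ) r with hsr | hsr
  · rw [Nat.sub_eq_zero_of_le hsr] at h
    omega
  · rw [← h]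
    have : (t : ℕ) - r < s - r := by omega
    have := Nat.mul_lt_mul_of_pos_right this hn
    omega

/-- Consecutive filtration steps thus differ in at most one matrix entry, the source of the
dichotomy in `semiregular`. Positions below n are excluded because truncated subtraction makes them
ambiguous. -/
lemma eq_of_entryIndex_eq {r s r' s' : Fin n} {i : ℕ} (h : entryIndex r s = i + n)
    (h' : entryIndex r' s' = i + n) : r = r' ∧ s = s' := by
  unfold entryIndex at *
  have hr := r.2
  have hr' := r'.2
  have hn : 0 < n := by omega
  have e1 : (r : ℕ) = (i + n) % n := by
    rw [← h, add_comm, Nat.add_mul_mod_self_right, Nat.mod_eq_of_lt hr]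
  have e2 : (r' : ℕ) = (i + n) % n := by
    rw [← h', add_comm, Nat.add_mul_mod_self_right, Nat.mod_eq_of_lt hr']
  have err : (r : ℕ) = r' := e1.trans e2.symm
  have hmul : ((s : ℕ) - r) * n = (s' - r') * n := by omega
  have hsub := Nat.eq_of_mul_eq_mul_right hn hmul
  have hpos : (s : ℕ) - r ≠ 0 := by
    intro h0
    rw [h0] at h
    omega
  exact ⟨Fin.ext err, Fin.ext (by omega)⟩

/-- The matrices supported on the entries of position at least `i + n`. -/
def triangularIdeal (n : ℕ) (E : Type*) [Field E] (i : ℕ) :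
    AddSubgroup (Matrix (Fin n) (Fin n) E) where
  carrier := {N | ∀ r s, entryIndex r s < i + n → N r s = 0}
  zero_mem' := by intro r s _; rfl
  add_mem' := by
    intro a b ha hb r s h
    rw [Matrix.add_apply, ha r s h, hb r s h, add_zero]
  neg_mem' := by
    intro a ha r s h
    rw [Matrix.neg_apply, ha r s h, neg_zero]

lemma triangularIdeal_antitone : Antitone (triangularIdeal n E) :=
  fun i j hij _ hN r s h => hN r s (h.trans_le (by omega))

lemma mul_mem_triangularIdeal_left {a N : Matrix (Fin n) (Fin n) E} {i : ℕ}
    (ha : a.BlockTriangular id) (hN : N ∈ triangularIdeal n E i) :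
    a * N ∈ triangularIdeal n E i := by
  intro r s h
  rw [Matrix.mul_apply]
  refine Finset.sum_eq_zero fun t _ => ?_
  rcases lt_trichotomy t r with htr | rfl | hrt
  · rw [ha htr, zero_mul]
  · rw [hN t s h, mul_zero]
  · rw [hN t s (entryIndex_lt_of_lt_left hrt h.le), mul_zero]

lemma mul_mem_triangularIdeal_right {a N : Matrix (Fin n) (Fin n) E} {i : ℕ}
    (ha : a.BlockTriangular id) (hN : N ∈ triangularIdeal n E i) :
    N * a ∈ triangularIdeal n E i := by
  intro r s h
  rw [Matrix.mul_apply]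
  refine Finset.sum_eq_zero fun t _ => ?_
  rcases le_or_gt t s with hts | hts
  · rw [hN r t ((entryIndex_le_of_le_right hts).trans_lt h), zero_mul]
  · rw [ha hts, mul_zero]

/-- All other terms of the matrix product lie below the diagonal of `a` or at earlier positions of
`N`, so on the leading entry only scaling by a diagonal entry survives. -/
lemma mul_apply_of_entryIndex_eq_left {a N : Matrix (Fin n) (Fin n) E} {i : ℕ} {r s : Fin n}
    (ha : a.BlockTriangular id) (hN : N ∈ triangularIdeal n E i) (h : entryIndex r s = i + n) :
    (a * N) r s = a r r * N r s := by
  rw [Matrix.mul_apply]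
  refine Finset.sum_eq_single r (fun t _ htr => ?_) (by simp)
  rcases lt_or_gt_of_ne htr with htr | hrt
  · rw [ha htr, zero_mul]
  · rw [hN t s (entryIndex_lt_of_lt_left hrt h.le), mul_zero]

lemma mul_apply_of_entryIndex_eq_right {a N : Matrix (Fin n) (Fin n) E} {i : ℕ} {r s : Fin n}
    (ha : a.BlockTriangular id) (hN : N ∈ triangularIdeal n E i) (h : entryIndex r s = i + n) :
    (N * a) r s = N r s * a s s := by
  rw [Matrix.mul_apply]
  refine Finset.sum_eq_single s (fun t _ hts => ?_) (by simp)
  rcases lt_or_gt_of_ne hts with hts | hst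
  · rw [hN r t (entryIndex_lt_of_lt_right hts h), zero_mul]
  · rw [ha hst, mul_zero]

lemma le_of_entry_ne_zero {N : Matrix (Fin n) (Fin n) E} {i : ℕ}
    (hN : N ∈ triangularIdeal n E i) {r s : Fin n} (h : N r s ≠ 0) :
    (r : ℕ) + (i / n + 1) ≤ s := by
  have h1 : i + n ≤ entryIndex r s := by
    by_contra! hlt
    exact h (hN r s hlt)
  unfold entryIndex at h1
  have hr := r.2
  have hn : 0 < n := by omega
  have h2 : i / n + 1 ≤ (s : ℕ) - r := by
    rw [← Nat.add_div_right i hn]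
    have := Nat.div_le_div_right (c := n) h1
    rwa [add_comm (((s : ℕ) - r) * n), Nat.add_mul_div_right _ _ hn, Nat.div_eq_of_lt hr,
      zero_add] at this
  generalize i / n = q at h2 ⊢
  omega

lemma mem_triangularIdeal_of_forall {N : Matrix (Fin n) (Fin n) E} {j : ℕ}
    (h : ∀ r s : Fin n, N r s ≠ 0 → (r : ℕ) + (j + 1) ≤ s) : N ∈ triangularIdeal n E (n * j) := by
  intro r s hrs
  by_contra hne
  have h1 := h r s hne
  unfold entryIndex at hrs
  have h2 : j + 1 ≤ (s : ℕ) - r := by omega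
  have h3 := Nat.mul_le_mul_right n h2
  have : (j + 1) * n = n * j + n := by ring
  omega

/-- A matrix in the i-th step is supported on superdiagonals of distance at least i / n + 1 from the
diagonal, and these distances add under multiplication. -/
lemma mul_mem_triangularIdeal {N N' : Matrix (Fin n) (Fin n) E} {i j : ℕ}
    (hN : N ∈ triangularIdeal n E i) (hN' : N' ∈ triangularIdeal n E j) :
    N * N' ∈ triangularIdeal n E (n * (i / n + j / n + 1)) := by
  refine mem_triangularIdeal_of_forall fun r s h => ?_
  rw [Matrix.mul_apply] at h
  obtain ⟨t, -, ht⟩ := Finset.exists_ne_zero_of_sum_ne_zero h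
  have h1 := le_of_entry_ne_zero hN (left_ne_zero_of_mul ht)
  have h2 := le_of_entry_ne_zero hN' (right_ne_zero_of_mul ht)
  omega

lemma eq_zero_of_mem_triangularIdeal {N : Matrix (Fin n) (Fin n) E}
    (hN : N ∈ triangularIdeal n E (n * n - n)) : N = 0 := by
  ext r s
  by_contra hne
  have h := le_of_entry_ne_zero hN hne
  have hr := r.2
  have hs := s.2
  have hn : 0 < n := by omega
  have : (n * n - n) / n = n - 1 := by
    rw [← Nat.mul_sub_one, Nat.mul_div_cancel_left _ hn]
  omega

end Triangular

/-! ### Groups of triangular matrices are layered -/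

/-- A group of upper triangular matrices. -/
structure IsTriangularRep {n : ℕ} {E : Type*} [Field E] {H : Type*} [Group H]
    (ρ : H →* Matrix (Fin n) (Fin n) E) : Prop where
  injective : Function.Injective ρ
  triangular : ∀ h, (ρ h).BlockTriangular id

namespace IsTriangularRep

variable {n : ℕ} {E : Type*} [Field E] {H : Type*} [Group H]
  {ρ : H →* Matrix (Fin n) (Fin n) E}

/-- The filtration of a group of upper triangular matrices by unipotent subgroups. -/
def filtration (hρ : IsTriangularRep ρ) (i : ℕ) : Subgroup H where
  carrier := {h | ρ h - 1 ∈ triangularIdeal n E i}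
  one_mem' := by
    change ρ 1 - 1 ∈ triangularIdeal n E i
    rw [map_one, sub_self]
    exact zero_mem _
  mul_mem' := by
    intro x y hx hy
    change ρ (x * y) - 1 ∈ triangularIdeal n E i
    have : ρ (x * y) - 1 = (ρ x - 1) * ρ y + (ρ y - 1) := by rw [map_mul]; noncomm_ring
    rw [this]
    exact add_mem (mul_mem_triangularIdeal_right (hρ.triangular y) hx) hy
  inv_mem' := by
    intro x hx
    change ρ x⁻¹ - 1 ∈ triangularIdeal n E i
    have : ρ x⁻¹ - 1 = -(ρ x⁻¹ * (ρ x - 1)) := by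
      rw [mul_sub, ← map_mul, inv_mul_cancel, map_one]; noncomm_ring
    rw [this]
    exact neg_mem (mul_mem_triangularIdeal_left (hρ.triangular _) hx)

lemma mem_filtration (hρ : IsTriangularRep ρ) {i : ℕ} {h : H} :
    h ∈ hρ.filtration i ↔ ρ h - 1 ∈ triangularIdeal n E i := Iff.rfl

lemma filtration_normal (hρ : IsTriangularRep ρ) (i : ℕ) : (hρ.filtration i).Normal where
  conj_mem x hx g := by
    rw [mem_filtration] at *
    have : ρ (g * x * g⁻¹) - 1 = ρ g * (ρ x - 1) * ρ g⁻¹ := by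
      have h1 : ρ g * ρ g⁻¹ = 1 := by rw [← map_mul, mul_inv_cancel, map_one]
      rw [map_mul, map_mul, mul_sub, sub_mul, mul_one, h1]
    rw [this]
    exact mul_mem_triangularIdeal_right (hρ.triangular _)
      (mul_mem_triangularIdeal_left (hρ.triangular _) hx)

lemma filtration_antitone (hρ : IsTriangularRep ρ) : Antitone hρ.filtration :=
  fun _ _ hij _ hx => triangularIdeal_antitone hij hx

lemma filtration_eq_bot (hρ : IsTriangularRep ρ) : hρ.filtration (n * n - n) = ⊥ := by
  rw [eq_bot_iff]
  intro x hx
  have h1 := eq_zero_of_mem_triangularIdeal hx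
  rw [sub_eq_zero, ← map_one ρ] at h1
  exact Subgroup.mem_bot.2 (hρ.injective h1)

lemma map_commutator_sub_one (x y : H) :
    ρ ⁅x, y⁆ - 1 = ((ρ x - 1) * (ρ y - 1) - (ρ y - 1) * (ρ x - 1)) * ρ (x⁻¹ * y⁻¹) := by
  have h1 : ρ y * ρ x * ρ (x⁻¹ * y⁻¹) = 1 := by
    rw [← map_mul, ← map_mul, ← map_one ρ]
    congr 1
    group
  have h2 : ρ ⁅x, y⁆ = ρ x * ρ y * ρ (x⁻¹ * y⁻¹) := by
    rw [← map_mul, ← map_mul, commutatorElement_def]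
    congr 1
    group
  have h3 : (ρ x - 1) * (ρ y - 1) - (ρ y - 1) * (ρ x - 1) = ρ x * ρ y - ρ y * ρ x := by
    noncomm_ring
  rw [h2, h3, sub_mul, h1]

/-- Up to a triangular factor, a group commutator minus one is the ring commutator of x - 1 and y -
1. The bound reaches the next full superdiagonal, which later yields a central series of length n -
1 rather than one of length n² - n. -/
lemma commutator_filtration_le (hρ : IsTriangularRep ρ) (i : ℕ) :
    ⁅hρ.filtration i, hρ.filtration 0⁆ ≤ hρ.filtration (n * (i / n + 1)) := by
  refine Subgroup.commutator_le.2 fun x hx y hy => ?_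
  rw [mem_filtration, map_commutator_sub_one]
  refine mul_mem_triangularIdeal_right (hρ.triangular _) (sub_mem ?_ ?_)
  · simpa using mul_mem_triangularIdeal hx hy
  · simpa using mul_mem_triangularIdeal hy hx

lemma commutator_filtration_le_succ (hρ : IsTriangularRep ρ) (i : ℕ) :
    ⁅hρ.filtration i, hρ.filtration 0⁆ ≤ hρ.filtration (i + 1) := by
  rcases Nat.eq_zero_or_pos n with rfl | hn
  · have : hρ.filtration (i + 1) = ⊤ := by
      rw [eq_top_iff]
      intro x _ r
      exact r.elim0
    rw [this]
    exact le_top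
  · refine (hρ.commutator_filtration_le i).trans (hρ.filtration_antitone ?_)
    rw [mul_add, mul_one]
    have := Nat.lt_mul_div_succ i hn
    rwa [mul_add, mul_one] at this

lemma diag_mul (hρ : IsTriangularRep ρ) (x y : H) (r : Fin n) :
    ρ (x * y) r r = ρ x r r * ρ y r r := by
  rw [map_mul, Matrix.mul_apply]
  refine Finset.sum_eq_single r (fun t _ htr => ?_) (by simp)
  rcases lt_or_gt_of_ne htr with h | h
  · rw [hρ.triangular x h, zero_mul]
  · rw [hρ.triangular y h, mul_zero]

/-- The diagonal characters of a group of triangular matrices. -/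
def diag (hρ : IsTriangularRep ρ) : H →* (Fin n → E) where
  toFun h r := ρ h r r
  map_one' := by
    funext r
    simp
  map_mul' x y := funext fun r => hρ.diag_mul x y r

lemma mem_filtration_zero (hρ : IsTriangularRep ρ) {h : H} :
    h ∈ hρ.filtration 0 ↔ hρ.diag h = 1 := by
  rw [mem_filtration]
  constructor
  · intro hh
    funext r
    have := hh r r (by simp [entryIndex])
    rw [Matrix.sub_apply, Matrix.one_apply_eq, sub_eq_zero] at this
    exact this
  · intro hh r s hrs
    have hsr : s ≤ r := by
      by_contra! hlt
      have hlt' : (r : ℕ) < s := hlt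
      have h1 : 1 ≤ (s : ℕ) - r := by omega
      have h2 := Nat.mul_le_mul_right n h1
      unfold entryIndex at hrs
      omega
    rcases hsr.lt_or_eq with h1 | rfl
    · rw [Matrix.sub_apply, hρ.triangular h h1, Matrix.one_apply_ne h1.ne', sub_zero]
    · rw [Matrix.sub_apply, Matrix.one_apply_eq, sub_eq_zero]
      exact congrFun hh s

/-- Only one entry (r, s) distinguishes consecutive filtration steps, and there the commutator with
g multiplies by g_rr / g_ss - 1, which is either zero or invertible in the field. -/
lemma semiregular (hρ : IsTriangularRep ρ) (i : ℕ) (g : H) :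
    (∀ x ∈ hρ.filtration i, ⁅g, x⁆ ∈ hρ.filtration (i + 1)) ∨
      (∀ x ∈ hρ.filtration i, ⁅g, x⁆ ∈ hρ.filtration (i + 1) → x ∈ hρ.filtration (i + 1)) := by
  have hsucc : ∀ {N : Matrix (Fin n) (Fin n) E}, N ∈ triangularIdeal n E i →
      (N ∈ triangularIdeal n E (i + 1) ↔ ∀ r s, entryIndex r s = i + n → N r s = 0) := by
    intro N hN
    refine ⟨fun h r s hrs => h r s (by omega), fun h r s hrs => ?_⟩
    rcases Nat.lt_or_ge (entryIndex r s) (i + n) with h1 | h1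
    · exact hN r s h1
    · exact h r s (by omega)
  have hentry : ∀ x ∈ hρ.filtration i, ∀ r s, entryIndex r s = i + n →
      (ρ ⁅g, x⁆ - 1) r s = (ρ g r r * ρ g⁻¹ s s - 1) * (ρ x - 1) r s := by
    intro x hx r s hrs
    rw [mem_filtration] at hx
    have hg1 : ρ g * ρ g⁻¹ = 1 := by rw [← map_mul, mul_inv_cancel, map_one]
    have hx1 : ρ x * ρ x⁻¹ = 1 := by rw [← map_mul, mul_inv_cancel, map_one]
    have e : ρ ⁅g, x⁆ - 1 = (ρ g * (ρ x - 1) * ρ g⁻¹ - (ρ x - 1)) * ρ x⁻¹ := by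
      have h1 : ρ g * (ρ x - 1) * ρ g⁻¹ = ρ g * ρ x * ρ g⁻¹ - 1 := by
        rw [mul_sub, sub_mul, mul_one, hg1]
      rw [h1, commutatorElement_def, map_mul, map_mul, map_mul, sub_sub_sub_cancel_right, sub_mul,
        hx1]
    have hmem := mul_mem_triangularIdeal_left (hρ.triangular g) hx
    have hmem' := mul_mem_triangularIdeal_right (hρ.triangular g⁻¹) hmem
    have hx0 : x⁻¹ ∈ hρ.filtration 0 :=
      inv_mem (hρ.filtration_antitone (Nat.zero_le i) hx)
    have hxs : ρ x⁻¹ s s = 1 := congrFun (hρ.mem_filtration_zero.1 hx0) s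
    rw [e, mul_apply_of_entryIndex_eq_right (hρ.triangular _) (sub_mem hmem' hx) hrs, hxs, mul_one,
      Matrix.sub_apply (ρ g * (ρ x - 1) * ρ g⁻¹),
      mul_apply_of_entryIndex_eq_right (hρ.triangular _) hmem hrs,
      mul_apply_of_entryIndex_eq_left (hρ.triangular _) hx hrs]
    ring
  have hcomm : ∀ x ∈ hρ.filtration i, ⁅g, x⁆ ∈ hρ.filtration i := by
    intro x hx
    rw [commutatorElement_def]
    exact mul_mem ((hρ.filtration_normal i).conj_mem x hx g) (inv_mem hx)
  by_cases hc : ∀ r s : Fin n, entryIndex r s = i + n → ρ g r r * ρ g⁻¹ s s = 1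
  · left
    intro x hx
    rw [mem_filtration, hsucc (hcomm x hx)]
    intro r s hrs
    rw [hentry x hx r s hrs, hc r s hrs, sub_self, zero_mul]
  · right
    push Not at hc
    obtain ⟨r, s, hrs, hne⟩ := hc
    intro x hx hgx
    rw [mem_filtration, hsucc (hcomm x hx)] at hgx
    rw [mem_filtration, hsucc hx]
    intro r' s' hrs'
    obtain ⟨rfl, rfl⟩ := eq_of_entryIndex_eq hrs hrs'
    have h1 := hgx r s hrs
    rw [hentry x hx r s hrs] at h1
    exact (mul_eq_zero.1 h1).resolve_left (sub_ne_zero.2 hne)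

/-- Here x - 1 is nilpotent of order at most n ≤ p^n, and in characteristic p its p^n-th power is
x^(p^n) - 1. -/
lemma isPGroup_filtration (hρ : IsTriangularRep ρ) (p : ℕ) [Fact p.Prime] [CharP E p] :
    IsPGroup p (hρ.filtration 0) := by
  rintro ⟨x, hx⟩
  rcases Nat.eq_zero_or_pos n with hn | hn
  · subst hn
    refine ⟨0, Subtype.ext (hρ.injective ?_)⟩
    exact Matrix.ext fun r => r.elim0
  have : Nonempty (Fin n) := ⟨⟨0, hn⟩⟩
  refine ⟨n, Subtype.ext (hρ.injective ?_)⟩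
  have hpow : ∀ k : ℕ, (ρ x - 1) ^ (k + 1) ∈ triangularIdeal n E (n * k) := by
    intro k
    induction k with
    | zero => simpa using hρ.mem_filtration.1 hx
    | succ k ih =>
      rw [pow_succ]
      have := mul_mem_triangularIdeal ih hx
      rwa [Nat.mul_div_cancel_left _ hn, Nat.zero_div, add_zero] at this
  have hzero : (ρ x - 1) ^ n = 0 := by
    refine eq_zero_of_mem_triangularIdeal ?_
    have := hpow (n - 1)
    rwa [Nat.sub_add_cancel hn, Nat.mul_sub_one] at this
  have hle : n ≤ p ^ n := (Nat.lt_pow_self (Fact.out : p.Prime).one_lt).le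
  have h1 : (ρ x - 1) ^ p ^ n = 0 := pow_eq_zero_of_le hle hzero
  have h2 : (ρ x - 1) ^ p ^ n = ρ x ^ p ^ n - 1 := by
    rw [sub_pow_char_pow_of_commute _ _ (Commute.one_right _), one_pow]
  rw [h2, sub_eq_zero] at h1
  change ρ (x ^ p ^ n) = ρ 1
  rw [map_pow, h1, map_one]

/-- The quotient embeds into diagonal matrices, and a field of characteristic p has no nontrivial
p-th roots of unity; Cauchy's theorem does the rest. -/
lemma coprime_index (hρ : IsTriangularRep ρ) (p : ℕ) [Fact p.Prime] [CharP E p] [Finite H] :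
    p.Coprime (hρ.filtration 0).index := by
  have := hρ.filtration_normal 0
  rw [(Fact.out : p.Prime).coprime_iff_not_dvd]
  intro hdvd
  rw [Subgroup.index_eq_card] at hdvd
  obtain ⟨x, hx⟩ := exists_prime_orderOf_dvd_card' p hdvd
  obtain ⟨h, rfl⟩ := QuotientGroup.mk_surjective x
  have hp : h ^ p ∈ hρ.filtration 0 := by
    rw [← QuotientGroup.eq_one_iff, QuotientGroup.mk_pow, ← hx, pow_orderOf_eq_one]
  have hmem : h ∈ hρ.filtration 0 := by
    rw [mem_filtration_zero, map_pow] at *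
    funext r
    have h1 : hρ.diag h r ^ p = 1 := congrFun hp r
    have h2 : (hρ.diag h r - 1) ^ p = 0 := by
      rw [sub_pow_char, h1, one_pow, sub_self]
    exact sub_eq_zero.1 (pow_eq_zero_iff (Fact.out : p.Prime).ne_zero |>.1 h2)
  rw [(QuotientGroup.eq_one_iff h).2 hmem, orderOf_one] at hx
  exact (Fact.out : p.Prime).one_lt.ne hx

/-- A finite group of upper triangular matrices in positive characteristic is layered. -/
theorem exists_isLayered (hρ : IsTriangularRep ρ) (p : ℕ) [Fact p.Prime] [CharP E p] [Finite H] :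
    ∃ T : Subgroup H, IsLayered (n * n - n) hρ.filtration T := by
  have hn := hρ.filtration_normal 0
  obtain ⟨k, hk⟩ := IsPGroup.iff_card.1 (hρ.isPGroup_filtration p)
  have hcop : (Nat.card (hρ.filtration 0)).Coprime (hρ.filtration 0).index := by
    rw [hk]
    exact (hρ.coprime_index p).pow_left k
  -- A Schur–Zassenhaus complement. It is abelian because its commutators have trivial diagonal,
  -- hence lie in its intersection with the unipotent part.
  obtain ⟨T, hT⟩ := Subgroup.exists_right_complement'_of_coprime hcop
  refine ⟨T, hρ.filtration_normal, hρ.filtration_antitone, hρ.filtration_eq_bot,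
    hρ.commutator_filtration_le_succ, hT.sup_eq_top, ?_, ?_, hρ.semiregular⟩
  · intro s hs t ht
    rw [← commutatorElement_eq_one_iff_mul_comm]
    have h1 : ⁅s, t⁆ ∈ hρ.filtration 0 := by
      rw [mem_filtration_zero, commutatorElement_def]
      simp only [map_mul]
      have hs1 : hρ.diag s * hρ.diag s⁻¹ = 1 := by rw [← map_mul, mul_inv_cancel, map_one]
      have ht1 : hρ.diag t * hρ.diag t⁻¹ = 1 := by rw [← map_mul, mul_inv_cancel, map_one]
      calc _ = (hρ.diag s * hρ.diag s⁻¹) * (hρ.diag t * hρ.diag t⁻¹) := by ring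
        _ = 1 := by rw [hs1, ht1, one_mul]
    have h2 : ⁅s, t⁆ ∈ T := by
      rw [commutatorElement_def]
      exact mul_mem (mul_mem (mul_mem hs ht) (inv_mem hs)) (inv_mem ht)
    exact Subgroup.disjoint_def.1 hT.disjoint h1 h2
  · rw [← hT.symm.index_eq_card] at *
    exact hcop

end IsTriangularRep

/-! ### From the hypotheses to growth data -/

open Finset in
/-- A symmetric generating set with tripling constant less than `√2` has full square. -/
lemma mem_sq_of_small_tripling {G : Type*} [Group G] [DecidableEq G] {A : Finset G} {K : ℝ}
    (hA : A⁻¹ = A) (h1 : 1 ∈ A) (hgen : Subgroup.closure (A : Set G) = ⊤)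
    (hK : (#(A ^ 3) : ℝ) ≤ K * #A) (hK2 : K ^ 2 < 2) (x : G) : x ∈ A ^ 2 := by
  have hpos : (0 : ℝ) < #A := by exact_mod_cast card_pos.2 ⟨1, h1⟩
  have h4 : #(A ^ 4) < 2 * #A := by
    have := small_pow_of_small_tripling (m := 4) (by norm_num) hK hA
    have h5 : (#(A ^ 4) : ℝ) < 2 * #A := this.trans_lt (by
      norm_num
      nlinarith)
    exact_mod_cast h5
  -- For y in A³ outside A², the translate yA is disjoint from `A` and both lie in A⁴, against |A⁴|
  -- ≤ K²|A| < 2|A|.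
  have h32 : ∀ y ∈ A ^ 3, y ∈ A ^ 2 := by
    intro y hy
    by_contra hy2
    have hdisj : Disjoint (A.image fun a => y * a) A := by
      rw [Finset.disjoint_left]
      intro z hz hzA
      obtain ⟨a, ha, rfl⟩ := mem_image.1 hz
      apply hy2
      have ha' : a⁻¹ ∈ A ^ 1 := inv_mem_pow hA (by simpa using ha)
      have := mul_mem_pow_add (show y * a ∈ A ^ 1 by simpa using hzA) ha'
      rwa [mul_inv_cancel_right] at this
    have hsub : (A.image fun a => y * a) ∪ A ⊆ A ^ 4 := by
      refine union_subset (fun z hz => ?_) ?_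
      · obtain ⟨a, ha, rfl⟩ := mem_image.1 hz
        exact mul_mem_pow_add (k := 1) hy (by simpa using ha)
      · intro z hz
        exact Finset.pow_subset_pow_right h1 (show 1 ≤ 4 by norm_num) (by simpa using hz)
    have := card_le_card hsub
    rw [card_union_of_disjoint hdisj, card_image_of_injective _ (mul_right_injective y)] at this
    omega
  let S : Subgroup G :=
    { carrier := {y | y ∈ A ^ 2}
      one_mem' := Finset.one_mem_pow h1
      mul_mem' := by
        intro a b ha hb
        obtain ⟨c, hc, d, hd, rfl⟩ := Finset.mem_mul.1 (show a ∈ A * A by rwa [← sq])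
        have h3 : d * b ∈ A ^ 3 := by
          have := mul_mem_pow_add (show d ∈ A ^ 1 by simpa using hd) hb
          exact this
        have h4 := mul_mem_pow_add (show c ∈ A ^ 1 by simpa using hc) (h32 _ h3)
        rw [← mul_assoc] at h4
        exact h32 _ h4
      inv_mem' := fun ha => inv_mem_pow hA ha }
  have hS : Subgroup.closure (A : Set G) ≤ S := by
    rw [Subgroup.closure_le]
    intro a ha
    exact Finset.pow_subset_pow_right h1 (show 1 ≤ 2 by norm_num) (by simpa using ha)
  exact hS (hgen ▸ Subgroup.mem_top x)

/-- A set with no small roots has many images in the automorphism group of every layer of a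
layered group whose unipotent part is a `p`-group. -/
lemma HasNoSmallRoots.lt_ncard {p : ℕ} {S : Type*} [Group S] [Finite S] {L : ℕ}
    {U : ℕ → Subgroup S} {T : Subgroup S} (h : IsLayered L U T) (hp : IsPGroup p (U 0))
    {A : Set S} (h1 : 1 ∈ A) (hgen : Subgroup.closure A = ⊤) {R : ℝ}
    (hA : HasNoSmallRoots p A R) (i : ℕ) :
    (∀ g : S, ∀ x ∈ U i, ⁅g, x⁆ ∈ U (i + 1)) ∨
      R < ((fun g : S => (g : S ⧸ layerKernel (U i) (U (i + 1)) (h.normal i))) '' A).ncard := by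
  by_cases htriv : ∀ g : S, ∀ x ∈ U i, ⁅g, x⁆ ∈ U (i + 1)
  · exact Or.inl htriv
  right
  have hne : U i ≠ U (i + 1) := by
    intro he
    refine htriv fun g x hx => ?_
    rw [← he, commutatorElement_def]
    exact mul_mem ((h.normal i).conj_mem x hx g) (inv_mem hx)
  have hlt : U (i + 1) < U i := lt_of_le_of_ne (h.antitone (Nat.le_succ i)) hne.symm
  -- A layer need not be a composition factor, so a minimal normal X above U (i + 1) is taken. By
  -- the dichotomy, acting trivially on X / U (i + 1) forces acting trivially on the whole layer, so
  -- the root is nontrivial.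
  obtain ⟨X, ⟨hXn, hX1, hX2⟩, hXmin⟩ := Set.Finite.exists_minimal
    (Set.toFinite {X : Subgroup S | X.Normal ∧ U (i + 1) < X ∧ X ≤ U i})
    ⟨U i, h.normal i, hlt, le_rfl⟩
  have hcore : U 0 ≤ pCore p S := le_sSup ⟨h.normal 0, hp⟩
  let V : CompositionFactor (pCore p S) :=
    { top := X
      bot := U (i + 1)
      top_normal := hXn
      bot_normal := h.normal (i + 1)
      top_le := (hX2.trans (h.antitone (Nat.zero_le i))).trans hcore
      bot_lt_top := hX1
      eq_or_eq := by
        intro Z hZ hZ1 hZ2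
        rcases hZ1.eq_or_lt with he | hl
        · exact Or.inl he.symm
        · exact Or.inr (le_antisymm hZ2 (hXmin ⟨hZ, hl, hZ2.trans hX2⟩ hZ2)) }
  have hker : ∀ g, g ∈ V.rootKernel → ∀ x ∈ U i, ⁅g, x⁆ ∈ U (i + 1) := by
    intro g hg
    rcases h.semiregular i g with hg' | hg'
    · exact hg'
    · exact absurd (fun x hx => hg' x (hX2 hx) (hg x hx)) (not_le_of_gt hX1)
  have hroot : V.root ≠ 1 := by
    intro he
    refine htriv fun g => hker g ?_
    exact (QuotientGroup.eq_one_iff g).1 (DFunLike.congr_fun he g)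
  have hone : 1 < (V.root '' A).ncard := by
    by_contra! hle
    apply hroot
    have hsub := Set.ncard_le_one (Set.toFinite (V.root '' A)) |>.1 hle
    have hcl : Subgroup.closure A ≤ V.root.ker := by
      rw [Subgroup.closure_le]
      intro a ha
      have := hsub _ (Set.mem_image_of_mem V.root ha) _ (Set.mem_image_of_mem V.root h1)
      rwa [map_one] at this
    rw [hgen] at hcl
    exact MonoidHom.ext fun g => hcl (Subgroup.mem_top g)
  have hbig : R < (V.root '' A).ncard := by
    by_contra! hle
    exact hA ⟨V, hroot, hone, hle⟩
  refine hbig.trans_le (Nat.cast_le.2 (Set.ncard_image_le_of_forall (Set.toFinite A) ?_))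
  intro a _ b _ hab
  rw [QuotientGroup.eq] at hab
  exact QuotientGroup.eq.2 fun x hx => hab x (hX2 hx)

/-- A trigonalizable section in positive characteristic is layered, and the layers refine a central
series of length `n - 1` of the unipotent part. -/
lemma exists_isLayered_of_trigonalizable {n : ℕ} (hn : 2 ≤ n) {F : Type*} [Field F] [Finite F]
    (p : ℕ) [CharP F p] (Γ : Subgroup (Matrix.GeneralLinearGroup (Fin n) F)) (N : Subgroup Γ)
    [N.Normal] (h : IsTrigonalizableSection Γ N) :
    ∃ (U : ℕ → Subgroup (Γ ⧸ N)) (T : Subgroup (Γ ⧸ N)), IsLayered (n * n - n) U T ∧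
      IsPGroup p (U 0) ∧ gammaSeries (Γ ⧸ N) n ≤ ⁅U 0, T⁆ := by
  obtain ⟨B, ⟨E, _, _, g, hg⟩, hB⟩ := h
  have hp : Fact p.Prime := ⟨CharP.char_is_prime F p⟩
  have hE : CharP E p := charP_of_injective_algebraMap (algebraMap F E).injective p
  let H : Subgroup Γ := B.subgroupOf Γ
  let π : H →* Γ ⧸ N := (QuotientGroup.mk' N).comp H.subtype
  have hπ : Function.Surjective π := by
    intro x
    have hx : x ∈ sectionTrace (B : Set (Matrix.GeneralLinearGroup (Fin n) F)) Γ N := by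
      rw [hB]
      trivial
    obtain ⟨y, hy, rfl⟩ := hx
    exact ⟨⟨y, hy⟩, rfl⟩
  let σ : H →* Matrix.GeneralLinearGroup (Fin n) E :=
    (MulAut.conj g).toMonoidHom.comp ((Matrix.GeneralLinearGroup.map (algebraMap F E)).comp
      (Γ.subtype.comp H.subtype))
  let ρ : H →* Matrix (Fin n) (Fin n) E := (Units.coeHom _).comp σ
  have hρ : IsTriangularRep ρ := by
    refine ⟨?_, fun x => hg (x : Γ) x.2⟩
    intro x y hxy
    have hσ : σ x = σ y := Units.ext hxy
    have hmap : Matrix.GeneralLinearGroup.map (algebraMap F E) (x : Γ).1 =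
        Matrix.GeneralLinearGroup.map (algebraMap F E) (y : Γ).1 :=
      (MulAut.conj g).injective hσ
    refine Subtype.ext (Subtype.ext (Units.ext (Matrix.ext fun r s => ?_)))
    have hrs := congrArg (fun z : Matrix.GeneralLinearGroup (Fin n) E => z.1 r s) hmap
    exact (algebraMap F E).injective (by simpa using hrs)
  obtain ⟨T, hT⟩ := hρ.exists_isLayered p
  have hL := hT.map π hπ
  refine ⟨_, _, hL, (hρ.isPGroup_filtration p).map π, ?_⟩
  obtain ⟨k, rfl⟩ : ∃ k, n = k + 2 := ⟨n - 2, by omega⟩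
  -- Sampling the filtration at multiples of n gives the superdiagonal central series, which reaches
  -- the trivial group after n - 1 steps.
  have hle := hL.lowerCentralSeries_le (fun j => (hρ.filtration ((k + 2) * j)).map π)
    (fun j => (hρ.filtration_normal _).map π hπ) rfl
    (fun j => Subgroup.map_mono (hρ.filtration_antitone (Nat.zero_le _))) ?_ k
  · have hbot : hρ.filtration ((k + 2) * (k + 1)) = ⊥ := by
      rw [← hρ.filtration_eq_bot, ← Nat.mul_sub_one]
      rfl
    simp only [hbot, Subgroup.map_bot, bot_sup_eq] at hle
    exact hle
  · intro j
    rw [← Subgroup.map_commutator]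
    have := hρ.commutator_filtration_le ((k + 2) * j)
    rw [Nat.mul_div_cancel_left _ (by omega)] at this
    exact Subgroup.map_mono this

theorem mainTheorem7 (n : ℕ) (hn : 2 ≤ n) :
    ∃ C m : ℕ, ∀ (F : Type*) [Field F] [Finite F] (p : ℕ) [CharP F p]
      (Γ : Subgroup (Matrix.GeneralLinearGroup (Fin n) F)) (N : Subgroup Γ) [N.Normal],
      IsTrigonalizableSection Γ N →
      ∀ (A : Set (Γ ⧸ N)) (K : ℝ),
        A⁻¹ = A → 1 ∈ A →
        ((A ^ 3).ncard : ℝ) ≤ K * (A.ncard : ℝ) →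
        HasNoSmallRoots p A (K ^ C) →
        Subgroup.closure A = ⊤ →
        ((gammaSeries (Γ ⧸ N) n : Subgroup (Γ ⧸ N)) : Set (Γ ⧸ N)) ⊆ A ^ m := by
  classical
  set L := n * n - n with hL
  obtain ⟨m₀, hm₀⟩ : ∃ m₀, m₀ = commutatorLength (L + 1) + 2 := ⟨_, rfl⟩
  obtain ⟨m, hm⟩ : ∃ m, m = descentStep^[(L + 1) * (L + 1)] m₀ := ⟨_, rfl⟩
  -- The exponent is 3(18m + 21) + 2: the descent runs in quotients with constant K³, and the extra
  -- K² absorbs the factor 2 when K² ≥ 2. When K² < 2, already A² is the whole group.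
  refine ⟨54 * m + 65, m, ?_⟩
  intro F _ _ p _ Γ N _ htrig A K hinv hone hK hroots hgen
  obtain ⟨U, T, hU, hUp, hgamma⟩ := exists_isLayered_of_trigonalizable hn p Γ N htrig
  obtain ⟨A, rfl⟩ : ∃ A' : Finset (Γ ⧸ N), (A' : Set (Γ ⧸ N)) = A :=
    ⟨A.toFinite.toFinset, by simp⟩
  have hinv' : A⁻¹ = A := by
    rw [← Finset.coe_inj, Finset.coe_inv, hinv]
  have hone' : 1 ∈ A := by simpa using hone
  rw [← Finset.coe_pow, Set.ncard_coe_finset, Set.ncard_coe_finset] at hK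
  have hpos : (0 : ℝ) < A.card := by exact_mod_cast Finset.card_pos.2 ⟨1, hone'⟩
  have hmono : ∀ {j k : ℕ}, j ≤ k → ((A ^ j).card : ℝ) ≤ (A ^ k).card := fun hjk => by
    exact_mod_cast Finset.card_le_card (Finset.pow_subset_pow_right hone' hjk)
  have hK1 : 1 ≤ K := by
    have h1 := (hmono (show 1 ≤ 3 by norm_num)).trans hK
    rw [pow_one] at h1
    exact le_of_mul_le_mul_right (by rwa [one_mul]) hpos
  rw [← Finset.coe_pow]
  rcases lt_or_ge (K ^ 2) 2 with hK2 | hK2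
  · intro x _
    have hm2 : 2 ≤ m := by
      have := le_iterate_descentStep ((L + 1) * (L + 1)) m₀
      omega
    exact Finset.pow_subset_pow_right hone' hm2
      (mem_sq_of_small_tripling hinv' hone' hgen hK hK2 x)
  · have hdata : GrowthData L U T A K (K ^ (54 * m + 65)) :=
      { toIsLayered := hU
        inv_eq := hinv'
        one_mem := hone'
        closure_eq := hgen
        one_le := hK1
        growth := by
          intro k hk
          have hKk : K ≤ K ^ k := le_self_pow₀ hK1 (by omega)
          rcases Nat.lt_or_ge k 3 with hk3 | hk3
          · calc ((A ^ k).card : ℝ) ≤ (A ^ 3).card := hmono hk3.le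
              _ ≤ K * A.card := hK
              _ ≤ K ^ k * A.card := by gcongr
          · calc ((A ^ k).card : ℝ) ≤ K ^ (k - 2) * A.card :=
                  Finset.small_pow_of_small_tripling hk3 hK hinv'
              _ ≤ K ^ k * A.card := by
                gcongr
                omega
        roots := hroots.lt_ncard hU hUp hone hgen }
    intro x hx
    refine hdata.commutator_subset_pow hm₀ hm ?_ x (hgamma hx)
    have : K ^ (54 * m + 65) = K ^ 2 * K ^ (54 * m + 63) := by rw [← pow_add]; congr 1; omega
    rw [this]
    gcongr
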